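/- A $t$-$(v,k,\lambda)_2$ subspace design on a $v$-dimensional vector space $V$ over $\mathrm{GF}(2)$ is a set of $k$-dimensional subspaces of $V$ (called blocks) such that every $t$-dimensional subspace of $V$ is contained in exactly $\lambda$ blocks. A large set $\mathrm{LS}_2[3](2,k,v)$ is a partition of the set of all $k$-dimensional subspaces of $V$ into three disjoint $2$-$(v,k,\lambda)_2$ subspace designs with a common value of $\lambda$. Theorem. Let $v$ and $k$ be integers with $v \geq 8$ and $0 \leq k \leq v$, and let $\bar v,\bar k\in\{0,\ldots,5\}$ be the remainders of $v$ and $k$ modulo $6$. If $2 \leq \bar v < \bar k \leq 5$, then every $v$-dimensional vector space $V$ over $\mathrm{GF}(2)$ (in particular $\mathrm{GF}(2)^v$) admits a large set $\mathrm{LS}_2[3](2,k,v)$. -/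

import Mathlib

/-- The Grassmannian: the set of all `k`-dimensional subspaces of the finite-dimensional
vector space `V` over the finite field `F`. -/
def grassmannian (F V : Type*) [Field F] [Finite F] [AddCommGroup V] [Module F V]
    [FiniteDimensional F V] (k : ℕ) : Set (Submodule F V) :=
  {B | Module.finrank F B = k}

/-- `IsSubspaceDesign t v k l 𝓑`: the pair `(V, 𝓑)` is a (simple) `t`-`(v, k, l)_q` subspace
design, where `q` is the order of `F`: `V` has dimension `v`, the blocks are `k`-subspaces of `V`,
and every `t`-subspace of `V` lies in exactly `l` blocks.  All sets of subspaces are finite here,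
so `Set.ncard` is the true cardinality. -/
structure IsSubspaceDesign {F V : Type*} [Field F] [Finite F] [AddCommGroup V] [Module F V]
    [FiniteDimensional F V] (t v k l : ℕ) (𝓑 : Set (Submodule F V)) : Prop where
  dim_eq : Module.finrank F V = v
  subset_grassmannian : 𝓑 ⊆ grassmannian F V k
  ncard_eq : ∀ T ∈ grassmannian F V t, {B ∈ 𝓑 | T ≤ B}.ncard = l

/-- `IsLargeSet N t k v 𝓑`: the `N` sets `𝓑 i` form a large set `LS_q[N](t, k, v)` on `V`, where
`q` is the order of `F`: they are a partition of the set of all `k`-subspaces of `V` (into `N`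
nonempty, pairwise disjoint parts), and for one common value `l` each part is a
`t`-`(v, k, l)_q` subspace design. -/
structure IsLargeSet {F V : Type*} [Field F] [Finite F] [AddCommGroup V] [Module F V]
    [FiniteDimensional F V] (N t k v : ℕ) (𝓑 : Fin N → Set (Submodule F V)) : Prop where
  nonempty : ∀ i, (𝓑 i).Nonempty
  pairwise_disjoint : ∀ i j, i ≠ j → Disjoint (𝓑 i) (𝓑 j)
  iUnion_eq : ⋃ i, 𝓑 i = grassmannian F V k
  isDesign : ∃ l : ℕ, ∀ i, IsSubspaceDesign t v k l (𝓑 i)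

open Module Submodule

/-! Colour the `k`-subspaces by cube roots of unity. Since `1 + ω + ω² = 0` is, up to scaling, the
only rational relation between `1, ω, ω²`, the three colours are equally frequent above a subspace
`T` exactly when the values above `T` sum to zero. A large set of strength `t` is thus a colouring
whose sums vanish above every `T` of dimension less than `t + 1`, which is `HasNull V k (t + 1)`.
Colours can now be multiplied, and this drives the recursion.

Recursion (`hasNull_of_flag`): fix a complete flag `F` and `l < k`. For each `k`-subspace `B` the
dimension of `B ⊓ F i` jumps from `l` to `l + 1` at a unique `i`; give `B` the value `f i (B ⊓ F i)
* g i (B ⊔ F (i + 1))`. For a fixed `T`, either `T ⊓ F i` is small enough for `f i` to cancel, or `T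
⊔ F (i + 1)` is small enough for `g i` to cancel. Hence levels `a i` and `b i` combine to level `a i
+ b i`.

With `l = 5` the residues modulo 6 fit together (`hasNull_nullLevel`). The induction covers all `v %
6 < k % 6`, with the lower levels 1 and 2 for `v % 6 = 0` and `1`, since these occur in the
recursion. Duality and the recursion leave only `6 ≤ v ≤ 10`, `k ≤ 5`, and these cases come from `k
= 3, 4` in dimension 8 by quotients, duals and a Pascal-type step.

The two cases in dimension 8 are explicit colourings invariant under a cyclic linear group, so that
balance above planes has to be computed only for planes in a normal form modulo the group. -/

/-- The elements of a finite type that satisfy `p`, as a finset. -/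
noncomputable def finsetOf {α : Type*} [Finite α] (p : α → Prop) : Finset α :=
  (Set.toFinite {a | p a}).toFinset

@[simp]
theorem mem_finsetOf {α : Type*} [Finite α] {p : α → Prop} {a : α} : a ∈ finsetOf p ↔ p a := by
  simp [finsetOf]

theorem card_finsetOf {α : Type*} [Finite α] (p : α → Prop) :
    (finsetOf p).card = Nat.card {a // p a} := by
  rw [finsetOf, ← Set.ncard_eq_toFinset_card]
  rfl

/-! ### Null functions and their sums over intervals -/

section
variable {V : Type*} [AddCommGroup V] [Module (ZMod 2) V] [Finite V]

theorem card_submodule (B : Submodule (ZMod 2) V) : Nat.card B = 2 ^ finrank (ZMod 2) B := by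
  have := Module.natCard_eq_pow_finrank (K := ZMod 2) (V := B)
  simpa using this

theorem card_mem_not_mem (B H : Submodule (ZMod 2) V) :
    ((finsetOf fun x => x ∈ B ∧ x ∉ H).card : ℂ) =
      2 ^ finrank (ZMod 2) B - 2 ^ finrank (ZMod 2) (B ⊓ H : Submodule (ZMod 2) V) := by
  classical
  have h1 : (finsetOf fun x => x ∈ B).card = 2 ^ finrank (ZMod 2) B := by
    rw [card_finsetOf, ← card_submodule]
  have h2 : (finsetOf fun x => x ∈ B ⊓ H).card =
      2 ^ finrank (ZMod 2) (B ⊓ H : Submodule (ZMod 2) V) := by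
    rw [card_finsetOf, ← card_submodule]
  have h3 : (finsetOf fun x => x ∈ B) =
      (finsetOf fun x => x ∈ B ⊓ H) ∪ finsetOf fun x => x ∈ B ∧ x ∉ H := by
    ext x
    simp
    tauto
  have h4 : Disjoint (finsetOf fun x => x ∈ B ⊓ H) (finsetOf fun x => x ∈ B ∧ x ∉ H) := by
    rw [Finset.disjoint_left]
    intro x
    simp
    tauto
  rw [h3, Finset.card_union_of_disjoint h4, h2] at h1
  have := congrArg (Nat.cast (R := ℂ)) h1
  push_cast at this
  linear_combination this

/-- The sum of `f` over the `k`-dimensional subspaces between `T` and `H`. -/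
noncomputable def sumBetween (f : Submodule (ZMod 2) V → ℂ) (k : ℕ)
    (T H : Submodule (ZMod 2) V) : ℂ :=
  ∑ B ∈ finsetOf fun B : Submodule (ZMod 2) V => T ≤ B ∧ B ≤ H ∧ finrank (ZMod 2) B = k, f B

/-- Double count of the pairs `(x, B)` with `x ∈ B \ H`: each `B` occurs once for every vector it
has outside `H`. -/
theorem sum_sumBetween_sup_span (f : Submodule (ZMod 2) V → ℂ) (k : ℕ)
    (T H H' : Submodule (ZMod 2) V) :
    ∑ x ∈ finsetOf (fun x => x ∈ H' ∧ x ∉ H), sumBetween f k (T ⊔ span (ZMod 2) {x}) H' =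
      ∑ B ∈ finsetOf fun B : Submodule (ZMod 2) V => T ≤ B ∧ B ≤ H' ∧ finrank (ZMod 2) B = k,
        (2 ^ k - 2 ^ finrank (ZMod 2) (B ⊓ H : Submodule (ZMod 2) V)) * f B := by
  unfold sumBetween
  rw [Finset.sum_comm' (t' := finsetOf fun B : Submodule (ZMod 2) V =>
    T ≤ B ∧ B ≤ H' ∧ finrank (ZMod 2) B = k) (s' := fun B => finsetOf fun x => x ∈ B ∧ x ∉ H)]
  · refine Finset.sum_congr rfl fun B hB => ?_
    rw [mem_finsetOf] at hB
    rw [Finset.sum_const, nsmul_eq_mul, card_mem_not_mem, hB.2.2]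
  · intro x B
    simp only [mem_finsetOf, sup_le_iff, span_singleton_le_iff_mem]
    constructor
    · rintro ⟨⟨h1, h2⟩, ⟨h3, h4⟩, h5, h6⟩
      exact ⟨⟨h4, h2⟩, h3, h5, h6⟩
    · rintro ⟨⟨h4, h2⟩, h3, h5, h6⟩
      exact ⟨⟨h5 h4, h2⟩, ⟨h3, h4⟩, h5, h6⟩

theorem finrank_sup_span_of_notMem {T : Submodule (ZMod 2) V} {x : V} (hx : x ∉ T) :
    finrank (ZMod 2) (T ⊔ span (ZMod 2) {x} : Submodule (ZMod 2) V) = finrank (ZMod 2) T + 1 := by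
  have h := Submodule.finrank_sup_add_finrank_inf_eq T (span (ZMod 2) {x})
  have h0 : x ≠ 0 := fun h => hx (h ▸ T.zero_mem)
  rw [finrank_span_singleton h0] at h
  have : T ⊓ span (ZMod 2) {x} = ⊥ := by
    rw [eq_bot_iff]
    intro y hy
    obtain ⟨h1, h2⟩ := hy
    obtain ⟨a, rfl⟩ := mem_span_singleton.1 h2
    by_cases ha : a = 0
    · simp [ha]
    · exact absurd ((T.smul_mem_iff ha).1 h1) hx
  rw [this] at h
  simpa using h

/-- In the double count with `H = T`, every `B` above `T` has the same nonzero number `2 ^ k - 2 ^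
t` of vectors outside `T`. -/
theorem sumBetween_top_eq_zero_of_succ {f : Submodule (ZMod 2) V → ℂ} {k t : ℕ} (htk : t + 1 ≤ k)
    (hf : ∀ T : Submodule (ZMod 2) V, finrank (ZMod 2) T = t + 1 → sumBetween f k T ⊤ = 0)
    {T : Submodule (ZMod 2) V} (hT : finrank (ZMod 2) T = t) : sumBetween f k T ⊤ = 0 := by
  have h := sum_sumBetween_sup_span f k T T ⊤
  rw [Finset.sum_eq_zero] at h
  · have h2 : (2 ^ k - 2 ^ t : ℂ) * sumBetween f k T ⊤ = 0 := by
      rw [h]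
      unfold sumBetween
      rw [Finset.mul_sum]
      refine Finset.sum_congr rfl fun B hB => ?_
      rw [mem_finsetOf] at hB
      rw [inf_eq_right.2 hB.1, hT]
    refine (mul_eq_zero.1 h2).resolve_left ?_
    refine sub_ne_zero.2 ?_
    have : (2 : ℕ) ^ k ≠ 2 ^ t := (Nat.pow_lt_pow_right (by norm_num) htk).ne'
    exact_mod_cast this
  · intro x hx
    rw [mem_finsetOf] at hx
    exact hf _ (by rw [finrank_sup_span_of_notMem hx.2, hT])

/-- `f` sums to zero over the `k`-subspaces above any subspace of dimension less than `s`. -/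
def IsNull (f : Submodule (ZMod 2) V → ℂ) (k s : ℕ) : Prop :=
  ∀ T : Submodule (ZMod 2) V, finrank (ZMod 2) T < s → sumBetween f k T ⊤ = 0

theorem isNull_succ_of_finrank_eq {f : Submodule (ZMod 2) V → ℂ} {k s : ℕ} (hsk : s ≤ k)
    (hf : ∀ T : Submodule (ZMod 2) V, finrank (ZMod 2) T = s → sumBetween f k T ⊤ = 0) :
    IsNull f k (s + 1) := by
  have key : ∀ d ≤ s, ∀ T : Submodule (ZMod 2) V, finrank (ZMod 2) T = s - d →
      sumBetween f k T ⊤ = 0 := by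
    intro d
    induction d with
    | zero => exact fun _ T hT => hf T (by simpa using hT)
    | succ d ih =>
      intro hd T hT
      refine sumBetween_top_eq_zero_of_succ (t := s - (d + 1)) (by omega) (fun T' hT' => ?_) hT
      exact ih (by omega) T' (by omega)
  intro T hT
  exact key (s - finrank (ZMod 2) T) (by omega) T (by omega)

/-- Lowering the upper end by one dimension costs one level. Enlarge `H` to `H'` by one dimension;
the double count over `H' \ H` kills the sum over those `B ≤ H'` not inside `H`, and the sum over
all `B ≤ H'` is zero by induction. The difference is the sum below `H`. This is what makes duality
work. -/
theorem IsNull.sumBetween_eq_zero {f : Submodule (ZMod 2) V → ℂ} {k s : ℕ} (hf : IsNull f k s)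
    (c : ℕ) : ∀ T H : Submodule (ZMod 2) V, finrank (ZMod 2) H + c = finrank (ZMod 2) V →
      finrank (ZMod 2) T + c < s → sumBetween f k T H = 0 := by
  induction c with
  | zero =>
    intro T H hH hT
    rw [Submodule.eq_top_of_finrank_eq hH]
    exact hf T hT
  | succ c ih =>
    intro T H hH hT
    by_cases hTH : T ≤ H
    swap
    · refine Finset.sum_eq_zero fun B hB => ?_
      rw [mem_finsetOf] at hB
      exact absurd (hB.1.trans hB.2.1) hTH
    obtain ⟨x, hx⟩ : ∃ x, x ∉ H := by
      by_contra! h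
      have : H = ⊤ := eq_top_iff.2 fun y _ => h y
      rw [this, finrank_top] at hH
      omega
    set H' := H ⊔ span (ZMod 2) {x} with hH'
    have hfH' : finrank (ZMod 2) H' = finrank (ZMod 2) H + 1 := finrank_sup_span_of_notMem hx
    have h := sum_sumBetween_sup_span f k T H H'
    rw [Finset.sum_eq_zero] at h
    swap
    · intro y hy
      rw [mem_finsetOf] at hy
      have hyT : y ∉ T := fun h => hy.2 (hTH h)
      exact ih _ _ (by omega) (by rw [finrank_sup_span_of_notMem hyT]; omega)
    have hT' : sumBetween f k T H' = 0 := ih _ _ (by omega) (by omega)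
    have hin : ∀ B : Submodule (ZMod 2) V, B ≤ H' → ¬ B ≤ H → finrank (ZMod 2) B =
        finrank (ZMod 2) (B ⊓ H : Submodule (ZMod 2) V) + 1 := by
      intro B hB hBH
      have h1 := Submodule.finrank_sup_add_finrank_inf_eq B H
      have h2 : finrank (ZMod 2) (B ⊔ H : Submodule (ZMod 2) V) ≤ finrank (ZMod 2) H' :=
        Submodule.finrank_mono (sup_le hB le_sup_left)
      have h3 : finrank (ZMod 2) H < finrank (ZMod 2) (B ⊔ H : Submodule (ZMod 2) V) :=
        Submodule.finrank_lt_finrank_of_lt (right_lt_sup.2 hBH)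
      omega
    -- A `B ≤ H'` not inside `H` meets `H` in a hyperplane of `B`, so it has `2 ^ k / 2` vectors
    -- outside `H`.
    have h2 : (2 : ℂ) ^ k / 2 * (sumBetween f k T H' - sumBetween f k T H) = 0 := by
      rw [h]
      unfold sumBetween
      have hsub : (finsetOf fun B : Submodule (ZMod 2) V =>
          T ≤ B ∧ B ≤ H ∧ finrank (ZMod 2) B = k) ⊆ finsetOf fun B : Submodule (ZMod 2) V =>
          T ≤ B ∧ B ≤ H' ∧ finrank (ZMod 2) B = k := by
        intro B hB
        rw [mem_finsetOf] at hB ⊢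
        exact ⟨hB.1, hB.2.1.trans le_sup_left, hB.2.2⟩
      classical
      rw [← Finset.sum_sdiff hsub, ← Finset.sum_sdiff hsub, add_sub_cancel_right,
        Finset.sum_eq_zero (s := finsetOf fun B : Submodule (ZMod 2) V =>
          T ≤ B ∧ B ≤ H ∧ finrank (ZMod 2) B = k), add_zero, Finset.mul_sum]
      · refine Finset.sum_congr rfl fun B hB => ?_
        simp only [Finset.mem_sdiff, mem_finsetOf, not_and] at hB
        have := hin B hB.1.2.1 fun h => hB.2 hB.1.1 h hB.1.2.2
        rw [hB.1.2.2] at this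
        rw [this, pow_succ]
        ring
      · intro B hB
        rw [mem_finsetOf] at hB
        rw [inf_eq_left.2 hB.2.1, hB.2.2, sub_self, zero_mul]
    have h3 := (mul_eq_zero.1 h2).resolve_left (div_ne_zero (pow_ne_zero _ two_ne_zero) two_ne_zero)
    rw [hT', zero_sub, neg_eq_zero] at h3
    exact h3

end

/-! ### Transport to isomorphic spaces, quotients, subspaces and duals -/

/-- There is a null function with values in the cube roots of unity. -/
def HasNull (V : Type*) [AddCommGroup V] [Module (ZMod 2) V] [Finite V] (k s : ℕ) : Prop :=
  ∃ f : Submodule (ZMod 2) V → ℂ, (∀ B, f B ^ 3 = 1) ∧ IsNull f k s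

section
variable {V : Type*} [AddCommGroup V] [Module (ZMod 2) V] [Finite V]
  {W : Type*} [AddCommGroup W] [Module (ZMod 2) W] [Finite W]

theorem HasNull.congr {k s : ℕ} (h : HasNull V k s) (e : V ≃ₗ[ZMod 2] W) : HasNull W k s := by
  obtain ⟨f, h1, h2⟩ := h
  refine ⟨fun B => f (B.comap e.toLinearMap), fun B => h1 _, fun T hT => ?_⟩
  have hdim : ∀ B : Submodule (ZMod 2) W,
      finrank (ZMod 2) (B.comap e.toLinearMap) = finrank (ZMod 2) B := fun B => by
    have h := LinearEquiv.finrank_map_eq e (B.comap e.toLinearMap)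
    rwa [Submodule.map_comap_eq_of_surjective e.surjective, eq_comm] at h
  rw [← h2 (T.comap e.toLinearMap) (by rwa [hdim])]
  unfold sumBetween
  refine Finset.sum_nbij' (fun B => B.comap e.toLinearMap) (fun B => B.map e.toLinearMap)
    ?_ ?_ ?_ ?_ ?_
  · intro B hB
    simp only [mem_finsetOf, le_top, true_and] at hB ⊢
    exact ⟨Submodule.comap_mono hB.1, by rw [hdim, hB.2]⟩
  · intro B hB
    simp only [mem_finsetOf, le_top, true_and] at hB ⊢
    refine ⟨?_, by rw [← hB.2]; exact LinearEquiv.finrank_map_eq e B⟩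
    have := Submodule.map_mono (f := e.toLinearMap) hB.1
    rwa [Submodule.map_comap_eq_of_surjective e.surjective] at this
  · intro B _
    exact Submodule.map_comap_eq_of_surjective e.surjective B
  · intro B _
    exact Submodule.comap_map_eq_of_injective e.injective B
  · intro B _
    rfl

theorem HasNull.of_finrank_eq {k s : ℕ} (h : HasNull V k s)
    (hVW : finrank (ZMod 2) V = finrank (ZMod 2) W) : HasNull W k s :=
  h.congr (LinearEquiv.ofFinrankEq V W hVW)

theorem hasNull_zero (k : ℕ) : HasNull V k 0 :=
  ⟨fun _ => 1, fun _ => one_pow 3, fun _ hT => absurd hT (Nat.not_lt_zero _)⟩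

theorem hasNull_of_finrank_lt {k : ℕ} (s : ℕ) (h : finrank (ZMod 2) V < k) : HasNull V k s := by
  refine ⟨fun _ => 1, fun _ => one_pow 3, fun T _ => Finset.sum_eq_zero fun B hB => ?_⟩
  rw [mem_finsetOf] at hB
  have := Submodule.finrank_le B
  omega

instance finite_quotient_submodule (U : Submodule (ZMod 2) V) : Finite (V ⧸ U) :=
  Finite.of_surjective U.mkQ U.mkQ_surjective

instance finite_dual : Finite (Dual (ZMod 2) V) :=
  Module.finite_of_finite (ZMod 2)

theorem finrank_comap_mkQ (U : Submodule (ZMod 2) V) (B : Submodule (ZMod 2) (V ⧸ U)) :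
    finrank (ZMod 2) (B.comap U.mkQ) = finrank (ZMod 2) B + finrank (ZMod 2) U := by
  have h := LinearMap.finrank_range_add_finrank_ker (U.mkQ.domRestrict (B.comap U.mkQ))
  rw [LinearMap.range_domRestrict, Submodule.map_comap_eq_of_surjective U.mkQ_surjective,
    LinearMap.ker_domRestrict, Submodule.ker_mkQ] at h
  have hU : U ≤ B.comap U.mkQ := by
    conv_lhs => rw [← U.ker_mkQ]
    exact LinearMap.ker_le_comap _
  rw [← h, ← (Submodule.comapSubtypeEquivOfLe hU).finrank_eq]

theorem sumBetween_comap_mkQ (f : Submodule (ZMod 2) V → ℂ) (U : Submodule (ZMod 2) V) (k : ℕ)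
    (T : Submodule (ZMod 2) (V ⧸ U)) :
    sumBetween (fun B => f (B.comap U.mkQ)) k T ⊤ =
      sumBetween f (k + finrank (ZMod 2) U) (T.comap U.mkQ) ⊤ := by
  have hcomap : ∀ B : Submodule (ZMod 2) V, T.comap U.mkQ ≤ B → (B.map U.mkQ).comap U.mkQ = B := by
    intro B hB
    rw [Submodule.comap_map_eq, U.ker_mkQ, sup_eq_left]
    refine le_trans ?_ hB
    conv_lhs => rw [← U.ker_mkQ]
    exact LinearMap.ker_le_comap _
  unfold sumBetween
  refine Finset.sum_nbij' (fun B => B.comap U.mkQ) (fun B => B.map U.mkQ) ?_ ?_ ?_ ?_ ?_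
  · intro B hB
    simp only [mem_finsetOf, le_top, true_and] at hB ⊢
    exact ⟨Submodule.comap_mono hB.1, by rw [finrank_comap_mkQ, hB.2]⟩
  · intro B hB
    simp only [mem_finsetOf, le_top, true_and] at hB ⊢
    constructor
    · have := Submodule.map_mono (f := U.mkQ) hB.1
      rwa [Submodule.map_comap_eq_of_surjective U.mkQ_surjective] at this
    · have := finrank_comap_mkQ U (B.map U.mkQ)
      rw [hcomap B hB.1] at this
      omega
  · intro B _
    exact Submodule.map_comap_eq_of_surjective U.mkQ_surjective B
  · intro B hB
    simp only [mem_finsetOf, le_top, true_and] at hB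
    exact hcomap B hB.1
  · intro B _
    rfl

theorem HasNull.quotient {k s : ℕ} (U : Submodule (ZMod 2) V)
    (h : HasNull V (k + finrank (ZMod 2) U) (s + finrank (ZMod 2) U)) :
    HasNull (V ⧸ U) k s := by
  obtain ⟨f, h1, h2⟩ := h
  refine ⟨fun B => f (B.comap U.mkQ), fun B => h1 _, fun T hT => ?_⟩
  rw [sumBetween_comap_mkQ]
  exact h2 _ (by rw [finrank_comap_mkQ]; omega)

/-- Pulls a null function on the quotient back to `V`, where it controls the interval above `U`; its
values on subspaces not above `U` play no role. -/
theorem HasNull.exists_above {k s : ℕ} {U : Submodule (ZMod 2) V} (h : HasNull (V ⧸ U) k s) :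
    ∃ g : Submodule (ZMod 2) V → ℂ, (∀ B, g B ^ 3 = 1) ∧ ∀ T, U ≤ T →
      finrank (ZMod 2) T < s + finrank (ZMod 2) U →
      sumBetween g (k + finrank (ZMod 2) U) T ⊤ = 0 := by
  obtain ⟨f, h1, h2⟩ := h
  refine ⟨fun B => f (B.map U.mkQ), fun B => h1 _, fun T hUT hT => ?_⟩
  have hT' : (T.map U.mkQ).comap U.mkQ = T := by
    rw [Submodule.comap_map_eq, U.ker_mkQ, sup_eq_left.2 hUT]
  have hf := finrank_comap_mkQ U (T.map U.mkQ)
  have h3 := sumBetween_comap_mkQ (fun B => f (B.map U.mkQ)) U k (T.map U.mkQ)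
  rw [hT'] at h3 hf
  rw [← h3, ← h2 (T.map U.mkQ) (by omega)]
  simp only [Submodule.map_comap_eq_of_surjective U.mkQ_surjective]

theorem HasNull.exists_below {k s : ℕ} {U : Submodule (ZMod 2) V} (h : HasNull U k s) :
    ∃ g : Submodule (ZMod 2) V → ℂ, (∀ B, g B ^ 3 = 1) ∧ ∀ T, T ≤ U →
      finrank (ZMod 2) T < s → sumBetween g k T U = 0 := by
  obtain ⟨f, h1, h2⟩ := h
  refine ⟨fun B => f (B.comap U.subtype), fun B => h1 _, fun T hTU hT => ?_⟩
  have hdim : ∀ B : Submodule (ZMod 2) V, B ≤ U →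
      finrank (ZMod 2) (B.comap U.subtype) = finrank (ZMod 2) B := fun B hB =>
    (Submodule.comapSubtypeEquivOfLe hB).finrank_eq
  have hmap : ∀ B : Submodule (ZMod 2) V, B ≤ U → (B.comap U.subtype).map U.subtype = B := by
    intro B hB
    rw [Submodule.map_comap_subtype, inf_eq_right.2 hB]
  rw [← h2 (T.comap U.subtype) (by rwa [hdim T hTU])]
  unfold sumBetween
  refine Finset.sum_nbij' (fun B => B.comap U.subtype) (fun B => B.map U.subtype) ?_ ?_ ?_ ?_ ?_
  · intro B hB
    simp only [mem_finsetOf, le_top, true_and] at hB ⊢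
    exact ⟨Submodule.comap_mono hB.1, by rw [hdim B hB.2.1, hB.2.2]⟩
  · intro B hB
    simp only [mem_finsetOf, le_top, true_and] at hB ⊢
    refine ⟨?_, Submodule.map_subtype_le U B, ?_⟩
    · have := Submodule.map_mono (f := U.subtype) hB.1
      rwa [hmap T hTU] at this
    · rw [← hB.2]
      exact Submodule.finrank_map_subtype_eq U B
  · intro B hB
    simp only [mem_finsetOf] at hB
    exact hmap B hB.2.1
  · intro B _
    exact Submodule.comap_map_eq_of_injective U.injective_subtype B
  · intro B _
    rfl

/-- Annihilators turn the superspaces of `T` in the dual into the subspaces of a space of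
codimension `finrank T`. Their sum vanishes by `IsNull.sumBetween_eq_zero` with lower end `⊥`, so no
level is lost. -/
theorem HasNull.dual {k s : ℕ} (hk : k ≤ finrank (ZMod 2) V) (h : HasNull V k s) :
    HasNull (Dual (ZMod 2) V) (finrank (ZMod 2) V - k) s := by
  obtain ⟨f, h1, h2⟩ := h
  let e := Subspace.orderIsoFiniteDimensional (K := ZMod 2) (V := V)
  have hdim : ∀ B : Submodule (ZMod 2) (Dual (ZMod 2) V), finrank (ZMod 2) B +
      finrank (ZMod 2) B.dualCoannihilator = finrank (ZMod 2) V := fun B =>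
    Subspace.finrank_add_finrank_dualCoannihilator_eq B
  have hdim' : ∀ B : Submodule (ZMod 2) V, finrank (ZMod 2) B +
      finrank (ZMod 2) B.dualAnnihilator = finrank (ZMod 2) V := fun B =>
    Subspace.finrank_add_finrank_dualAnnihilator_eq B
  refine ⟨fun B => f B.dualCoannihilator, fun B => h1 _, fun T hT => ?_⟩
  rw [← h2.sumBetween_eq_zero (finrank (ZMod 2) T) ⊥ T.dualCoannihilator
    (by rw [← hdim T, add_comm]) (by rwa [finrank_bot, zero_add])]
  unfold sumBetween
  refine Finset.sum_nbij' (fun B => B.dualCoannihilator) (fun B => B.dualAnnihilator) ?_ ?_ ?_ ?_ ?_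
  · intro B hB
    simp only [mem_finsetOf, le_top, true_and, bot_le] at hB ⊢
    exact ⟨Submodule.dualCoannihilator_anti hB.1, by have := hdim B; omega⟩
  · intro B hB
    simp only [mem_finsetOf, le_top, true_and, bot_le] at hB ⊢
    refine ⟨?_, by have := hdim' B; omega⟩
    rw [← Subspace.dualCoannihilator_dualAnnihilator_eq (W := T)]
    exact Submodule.dualAnnihilator_anti hB.1
  · intro B _
    exact Subspace.dualCoannihilator_dualAnnihilator_eq
  · intro B _
    exact Subspace.dualAnnihilator_dualCoannihilator_eq
  · intro B _
    rfl

end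

/-! ### Automorphisms moving one subspace to another -/

section
variable {V : Type*} [AddCommGroup V] [Module (ZMod 2) V] [Finite V]

theorem exists_linearEquiv_extend {N N' : Submodule (ZMod 2) V} (g : N ≃ₗ[ZMod 2] N') :
    ∃ φ : V ≃ₗ[ZMod 2] V, ∀ x : N, φ x = g x := by
  obtain ⟨C, hC⟩ := Submodule.exists_isCompl N
  obtain ⟨C', hC'⟩ := Submodule.exists_isCompl N'
  have h1 := Submodule.finrank_add_eq_of_isCompl hC
  have h2 := Submodule.finrank_add_eq_of_isCompl hC'
  have h3 := g.finrank_eq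
  let e : C ≃ₗ[ZMod 2] C' := LinearEquiv.ofFinrankEq C C' (by omega)
  refine ⟨(N.prodEquivOfIsCompl C hC).symm ≪≫ₗ (g.prodCongr e) ≪≫ₗ N'.prodEquivOfIsCompl C' hC',
    fun x => ?_⟩
  have : (N.prodEquivOfIsCompl C hC).symm (x : V) = (x, 0) :=
    Submodule.prodEquivOfIsCompl_symm_apply_left N C hC x
  simp [this]

theorem exists_linearEquiv_fix_map {X N N' : Submodule (ZMod 2) V} (hN : X ≤ N) (hN' : X ≤ N')
    (h : finrank (ZMod 2) N = finrank (ZMod 2) N') :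
    ∃ φ : V ≃ₗ[ZMod 2] V, (∀ x ∈ X, φ x = x) ∧ N.map φ.toLinearMap = N' := by
  let e : N ≃ₗ[ZMod 2] N' := LinearEquiv.ofFinrankEq N N' h
  let X₁ : Submodule (ZMod 2) N := X.comap N.subtype
  let X' : Submodule (ZMod 2) N' := X.comap N'.subtype
  -- `e` need not fix `X`; `g` undoes `e` on the image of `X`, and following `e` by an extension of
  -- `g` to `N'` repairs this.
  let g : X₁.map e.toLinearMap ≃ₗ[ZMod 2] X' := (e.submoduleMap X₁).symm ≪≫ₗ
    Submodule.comapSubtypeEquivOfLe hN ≪≫ₗ (Submodule.comapSubtypeEquivOfLe hN').symm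
  obtain ⟨ψ, hψ⟩ := exists_linearEquiv_extend g
  obtain ⟨φ, hφ⟩ := exists_linearEquiv_extend (e ≪≫ₗ ψ)
  refine ⟨φ, fun x hx => ?_, ?_⟩
  · have h1 := hφ ⟨x, hN hx⟩
    rw [h1]
    have h2 := hψ ⟨e ⟨x, hN hx⟩, Submodule.mem_map_of_mem (show (⟨x, hN hx⟩ : N) ∈ X₁ from hx)⟩
    have h3 : (g ⟨e ⟨x, hN hx⟩, Submodule.mem_map_of_mem (show (⟨x, hN hx⟩ : N) ∈ X₁ from hx)⟩ : N')
        = ⟨x, hN' hx⟩ := by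
      have : (e.submoduleMap X₁).symm ⟨e ⟨x, hN hx⟩,
          Submodule.mem_map_of_mem (show (⟨x, hN hx⟩ : N) ∈ X₁ from hx)⟩ = ⟨⟨x, hN hx⟩, hx⟩ := by
        rw [LinearEquiv.symm_apply_eq]
        rfl
      simp only [g, LinearEquiv.trans_apply]
      rw [this]
      rfl
    rw [h3] at h2
    simpa using congrArg Subtype.val h2
  · refine Submodule.eq_of_le_of_finrank_eq ?_ ((LinearEquiv.finrank_map_eq φ N).trans h)
    rw [Submodule.map_le_iff_le_comap]
    intro x hx
    have := hφ ⟨x, hx⟩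
    change φ x ∈ N'
    rw [this]
    exact Subtype.property _

/-- Act on `U` by a map fixing `T ⊓ U`, and trivially on a complement `C` of `U`. Choosing `C` to
contain a complement of `T ⊓ U` in `T` makes the map fix `T`; being trivial modulo `U`, it preserves
every `P ≥ U`. -/
theorem exists_linearEquiv_fix_map_of_le {T U N N' : Submodule (ZMod 2) V} (hN : T ⊓ U ≤ N)
    (hN' : T ⊓ U ≤ N') (hNU : N ≤ U) (hNU' : N' ≤ U)
    (h : finrank (ZMod 2) N = finrank (ZMod 2) N') :
    ∃ φ : V ≃ₗ[ZMod 2] V, (∀ x ∈ T, φ x = x) ∧ N.map φ.toLinearMap = N' ∧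
      ∀ P, U ≤ P → P.map φ.toLinearMap = P := by
  obtain ⟨φ₀, h1, h2⟩ := exists_linearEquiv_fix_map (X := (T ⊓ U).comap U.subtype)
    (N := N.comap U.subtype) (N' := N'.comap U.subtype) (Submodule.comap_mono hN)
    (Submodule.comap_mono hN') (by
      rw [(Submodule.comapSubtypeEquivOfLe hNU).finrank_eq,
        (Submodule.comapSubtypeEquivOfLe hNU').finrank_eq, h])
  obtain ⟨T', hT'⟩ := Submodule.exists_isCompl ((T ⊓ U).comap T.subtype)
  have hdis : Disjoint U (T'.map T.subtype) := by
    rw [Submodule.disjoint_def]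
    rintro x hxU ⟨y, hy, rfl⟩
    have := Submodule.disjoint_def.1 hT'.disjoint y ⟨y.2, hxU⟩ hy
    rw [this, map_zero]
  obtain ⟨C, hTC, hC⟩ := hdis.symm.exists_isCompl
  let e := U.prodEquivOfIsCompl C hC.symm
  let φ : V ≃ₗ[ZMod 2] V := e.symm ≪≫ₗ (φ₀.prodCongr (LinearEquiv.refl (ZMod 2) C)) ≪≫ₗ e
  have hφU : ∀ x : U, φ x = φ₀ x := fun x => by
    have : e.symm (x : V) = (x, 0) := Submodule.prodEquivOfIsCompl_symm_apply_left U C hC.symm x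
    simp [φ, this, e]
  have hφC : ∀ x : C, φ x = x := fun x => by
    have : e.symm (x : V) = (0, x) := Submodule.prodEquivOfIsCompl_symm_apply_right U C hC.symm x
    simp [φ, this, e]
  refine ⟨φ, fun x hx => ?_, ?_, fun P hP => ?_⟩
  · have hx' : (⟨x, hx⟩ : T) ∈ (T ⊓ U).comap T.subtype ⊔ T' := by
      rw [hT'.sup_eq_top]
      trivial
    obtain ⟨a, ha, b, hb, hab⟩ := Submodule.mem_sup.1 hx'
    have hx2 : x = a + b := by
      have := congrArg Subtype.val hab
      simpa using this.symm
    have h3 := hφU ⟨a, ha.2⟩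
    have h4 := hφC ⟨b, hTC (Submodule.mem_map_of_mem hb)⟩
    rw [h1 ⟨a, ha.2⟩ ha] at h3
    simp only at h3 h4
    rw [hx2, map_add, h3, h4]
  · refine Submodule.eq_of_le_of_finrank_eq ?_ ((LinearEquiv.finrank_map_eq φ N).trans h)
    rw [Submodule.map_le_iff_le_comap]
    intro x hx
    change φ x ∈ N'
    have h3 := hφU ⟨x, hNU hx⟩
    simp only at h3
    rw [h3]
    have : φ₀ ⟨x, hNU hx⟩ ∈ N'.comap U.subtype := by
      rw [← h2]
      exact Submodule.mem_map_of_mem hx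
    exact this
  · refine Submodule.eq_of_le_of_finrank_eq ?_ (LinearEquiv.finrank_map_eq φ P)
    rw [Submodule.map_le_iff_le_comap]
    intro x hx
    change φ x ∈ P
    have hx' : x ∈ U ⊔ C := by
      rw [hC.symm.sup_eq_top]
      trivial
    obtain ⟨a, ha, b, hb, rfl⟩ := Submodule.mem_sup.1 hx'
    have h3 := hφU ⟨a, ha⟩
    have h4 := hφC ⟨b, hb⟩
    simp only at h3 h4
    rw [map_add, h3, h4]
    exact P.add_mem (hP (φ₀ ⟨a, ha⟩).2) ((P.add_mem_iff_right (hP ha)).1 hx)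

end

/-! ### Sums along `B ↦ B ⊓ U` and `B ↦ B ⊔ U` -/

theorem sum_comp_eq_zero_of_card_fiber {α β : Type*} [DecidableEq β] {s : Finset α} {t : Finset β}
    {π : α → β} {f : β → ℂ} (hπ : ∀ a ∈ s, π a ∈ t)
    (hcard : ∀ b ∈ t, ∀ b' ∈ t, (s.filter fun a => π a = b).card ≤ (s.filter fun a => π a = b').card)
    (hf : ∑ b ∈ t, f b = 0) : ∑ a ∈ s, f (π a) = 0 := by
  rw [← Finset.sum_fiberwise_of_maps_to hπ]
  rcases t.eq_empty_or_nonempty with rfl | ⟨b₀, hb₀⟩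
  · simp
  · have : ∀ b ∈ t, ∑ a ∈ s with π a = b, f (π a) = (s.filter fun a => π a = b₀).card * f b := by
      intro b hb
      rw [← (hcard b hb b₀ hb₀).antisymm (hcard b₀ hb₀ b hb), ← nsmul_eq_mul, ← Finset.sum_const]
      refine Finset.sum_congr rfl fun a ha => ?_
      rw [(Finset.mem_filter.1 ha).2]
    rw [Finset.sum_congr rfl this, ← Finset.mul_sum, hf, mul_zero]

theorem map_linearEquiv_inf {V : Type*} [AddCommGroup V] [Module (ZMod 2) V]
    (φ : V ≃ₗ[ZMod 2] V) (A B : Submodule (ZMod 2) V) :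
    (A ⊓ B).map φ.toLinearMap = A.map φ.toLinearMap ⊓ B.map φ.toLinearMap :=
  Submodule.map_inf φ.toLinearMap φ.injective

section
variable {V : Type*} [AddCommGroup V] [Module (ZMod 2) V] [Finite V]

/-- The fibres of `B ↦ B ⊓ U` over the admissible subspaces have equal size: automorphisms fixing
`T`, `U` and `P` permute these subspaces transitively. The sum is therefore a multiple of
`sumBetween f l (T ⊓ U) U`. -/
theorem sum_inf_eq_zero {f : Submodule (ZMod 2) V → ℂ} {k l : ℕ} {T U P : Submodule (ZMod 2) V}
    (hf : sumBetween f l (T ⊓ U) U = 0) :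
    ∑ B ∈ finsetOf fun B : Submodule (ZMod 2) V => T ≤ B ∧ finrank (ZMod 2) B = k ∧
      finrank (ZMod 2) (B ⊓ U : Submodule (ZMod 2) V) = l ∧ B ⊔ U = P, f (B ⊓ U) = 0 := by
  classical
  refine sum_comp_eq_zero_of_card_fiber (π := fun B => B ⊓ U) ?_ ?_ hf
  · intro B hB
    rw [mem_finsetOf] at hB ⊢
    exact ⟨inf_le_inf_right U hB.1, inf_le_right, hB.2.2.1⟩
  · intro N hN N' hN'
    rw [mem_finsetOf] at hN hN'
    obtain ⟨φ, h1, h2, h3⟩ := exists_linearEquiv_fix_map_of_le hN.1 hN'.1 hN.2.1 hN'.2.1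
      (hN.2.2.trans hN'.2.2.symm)
    refine Finset.card_le_card_of_injOn (fun B => B.map φ.toLinearMap) ?_
      (Submodule.map_injective_of_injective φ.injective).injOn
    intro B hB
    simp only [Finset.coe_filter, mem_finsetOf, Set.mem_ofPred_eq] at hB ⊢
    obtain ⟨⟨h4, h5, h6, h7⟩, h8⟩ := hB
    have hinf : B.map φ.toLinearMap ⊓ U = N' := by
      rw [← h2, ← h8, map_linearEquiv_inf, h3 U le_rfl]
    refine ⟨⟨?_, (LinearEquiv.finrank_map_eq φ B).trans h5, by rw [hinf]; exact hN'.2.2, ?_⟩, hinf⟩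
    · intro x hx
      exact ⟨x, h4 hx, h1 x hx⟩
    · rw [← h3 P (by rw [← h7]; exact le_sup_right), ← h7, Submodule.map_sup, h3 U le_rfl]

/-- The counterpart for joins. Automorphisms fixing `T ⊔ U` pointwise move any `P` to any `P'` and
preserve `N`, which lies in `U` unless the sum is empty. -/
theorem sum_sup_eq_zero {f : Submodule (ZMod 2) V → ℂ} {k l : ℕ} {T U N : Submodule (ZMod 2) V}
    (hf : sumBetween f l (T ⊔ U) ⊤ = 0) :
    ∑ B ∈ finsetOf fun B : Submodule (ZMod 2) V => T ≤ B ∧ finrank (ZMod 2) B = k ∧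
      finrank (ZMod 2) (B ⊔ U : Submodule (ZMod 2) V) = l ∧ B ⊓ U = N, f (B ⊔ U) = 0 := by
  classical
  refine sum_comp_eq_zero_of_card_fiber (π := fun B => B ⊔ U) ?_ ?_ hf
  · intro B hB
    rw [mem_finsetOf] at hB ⊢
    exact ⟨sup_le_sup_right hB.1 U, le_top, hB.2.2.1⟩
  · intro P hP P' hP'
    rw [mem_finsetOf] at hP hP'
    obtain ⟨φ, h1, h2⟩ := exists_linearEquiv_fix_map hP.1 hP'.1 (hP.2.2.trans hP'.2.2.symm)
    have hfix : ∀ A, A ≤ T ⊔ U → A.map φ.toLinearMap = A := by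
      intro A hA
      refine Submodule.eq_of_le_of_finrank_eq ?_ (LinearEquiv.finrank_map_eq φ A)
      rintro _ ⟨x, hx, rfl⟩
      change φ x ∈ A
      rwa [h1 x (hA hx)]
    have hU := hfix U le_sup_right
    refine Finset.card_le_card_of_injOn (fun B => B.map φ.toLinearMap) ?_
      (Submodule.map_injective_of_injective φ.injective).injOn
    intro B hB
    simp only [Finset.coe_filter, mem_finsetOf, Set.mem_ofPred_eq] at hB ⊢
    obtain ⟨⟨h4, h5, h6, h7⟩, h8⟩ := hB
    have hsup : B.map φ.toLinearMap ⊔ U = P' := by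
      rw [← h2, ← h8, Submodule.map_sup, hU]
    refine ⟨⟨?_, (LinearEquiv.finrank_map_eq φ B).trans h5, by rw [hsup]; exact hP'.2.2, ?_⟩, hsup⟩
    · rw [← hfix T le_sup_left]
      exact Submodule.map_mono h4
    · rw [← hfix N (by rw [← h7]; exact inf_le_right.trans le_sup_right), ← h7,
        map_linearEquiv_inf, hU]

end

/-! ### The flag construction and the Pascal step -/

section
variable {V : Type*} [AddCommGroup V] [Module (ZMod 2) V] [Finite V]

theorem sum_eq_sum_of_partition {α : Type*} {s : Finset α} {n : ℕ} {p : ℕ → α → Prop}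
    [∀ i, DecidablePred (p i)] (f : α → ℂ)
    (hp : ∀ a ∈ s, ∃! i, i < n ∧ p i a) :
    ∑ a ∈ s, f a = ∑ i ∈ Finset.range n, ∑ a ∈ s with p i a, f a := by
  simp_rw [Finset.sum_filter]
  rw [Finset.sum_comm]
  refine Finset.sum_congr rfl fun a ha => ?_
  obtain ⟨i, ⟨hi, hia⟩, huniq⟩ := hp a ha
  rw [Finset.sum_eq_single_of_mem i (Finset.mem_range.2 hi), if_pos hia]
  intro j hj hji
  rw [if_neg]
  intro h
  exact hji (huniq j ⟨Finset.mem_range.1 hj, h⟩)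

theorem exists_flag (V : Type*) [AddCommGroup V] [Module (ZMod 2) V] [Finite V] :
    ∃ F : ℕ → Submodule (ZMod 2) V, Monotone F ∧
      ∀ i ≤ finrank (ZMod 2) V, finrank (ZMod 2) (F i) = i := by
  have step : ∀ A : Submodule (ZMod 2) V, ∃ A' : Submodule (ZMod 2) V, A ≤ A' ∧
      (A ≠ ⊤ → finrank (ZMod 2) A' = finrank (ZMod 2) A + 1) := by
    intro A
    by_cases hA : A = ⊤
    · exact ⟨A, le_rfl, fun h => absurd hA h⟩
    · obtain ⟨x, hx⟩ : ∃ x, x ∉ A := by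
        by_contra! h
        exact hA (eq_top_iff.2 fun y _ => h y)
      exact ⟨A ⊔ span (ZMod 2) {x}, le_sup_left, fun _ => finrank_sup_span_of_notMem hx⟩
  choose g hg1 hg2 using step
  refine ⟨fun i => g^[i] ⊥, monotone_nat_of_le_succ fun i => ?_, fun i => ?_⟩
  · rw [Function.iterate_succ_apply']
    exact hg1 _
  · induction i with
    | zero => exact fun _ => finrank_bot _ _
    | succ i ih =>
      intro hi
      have h1 := ih (by omega)
      have hs : g^[i + 1] ⊥ = g (g^[i] ⊥) := Function.iterate_succ_apply' g i ⊥
      have hfin := congrArg (fun A : Submodule (ZMod 2) V => finrank (ZMod 2) A) hs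
      refine hfin.trans ((hg2 _ fun htop => ?_).trans (congrArg (· + 1) h1))
      have h2 := congrArg (fun A : Submodule (ZMod 2) V => finrank (ZMod 2) A) htop
      simp only [finrank_top] at h1 h2
      omega

/-- The dimension of the intersection of `B` with the members of the flag `F` jumps from `l` to
`l + 1` at index `i`. -/
def IsJump (F : ℕ → Submodule (ZMod 2) V) (l i : ℕ) (B : Submodule (ZMod 2) V) : Prop :=
  finrank (ZMod 2) (B ⊓ F i : Submodule (ZMod 2) V) = l ∧
    finrank (ZMod 2) (B ⊓ F (i + 1) : Submodule (ZMod 2) V) = l + 1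

/-- Along the flag the dimension of the intersection grows from `0` to `finrank B` in steps of at
most one, so it passes from `l` to `l + 1` exactly once. -/
theorem existsUnique_isJump {F : ℕ → Submodule (ZMod 2) V} (hF : Monotone F)
    (hdim : ∀ i ≤ finrank (ZMod 2) V, finrank (ZMod 2) (F i) = i) {l : ℕ}
    {B : Submodule (ZMod 2) V} (hB : l < finrank (ZMod 2) B) :
    ∃! i, i < finrank (ZMod 2) V ∧ IsJump F l i B := by
  classical
  have hmono : Monotone fun i => finrank (ZMod 2) (B ⊓ F i : Submodule (ZMod 2) V) := fun i j hij =>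
    Submodule.finrank_mono (inf_le_inf_left B (hF hij))
  have hstep : ∀ i < finrank (ZMod 2) V, finrank (ZMod 2) (B ⊓ F (i + 1) : Submodule (ZMod 2) V) ≤
      finrank (ZMod 2) (B ⊓ F i : Submodule (ZMod 2) V) + 1 := by
    intro i hi
    have h1 := Submodule.finrank_sup_add_finrank_inf_eq (B ⊓ F (i + 1)) (F i)
    have h2 : B ⊓ F (i + 1) ⊓ F i = B ⊓ F i := by
      rw [inf_assoc, inf_eq_right.2 (hF i.le_succ)]
    have h3 := Submodule.finrank_mono (sup_le inf_le_right (hF i.le_succ) :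
      B ⊓ F (i + 1) ⊔ F i ≤ F (i + 1))
    rw [h2, hdim i (by omega)] at h1
    rw [hdim (i + 1) (by omega)] at h3
    omega
  have hlast : F (finrank (ZMod 2) V) = ⊤ := Submodule.eq_top_of_finrank_eq (hdim _ le_rfl)
  have hex : ∃ j, l < finrank (ZMod 2) (B ⊓ F j : Submodule (ZMod 2) V) :=
    ⟨finrank (ZMod 2) V, by rwa [hlast, inf_top_eq]⟩
  have hle : Nat.find hex ≤ finrank (ZMod 2) V := Nat.find_min' hex (by rwa [hlast, inf_top_eq])
  have hpos : Nat.find hex ≠ 0 := by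
    intro h0
    have h1 := Nat.find_spec hex
    have h2 := Submodule.finrank_mono (inf_le_right : B ⊓ F (Nat.find hex) ≤ F (Nat.find hex))
    rw [hdim _ hle] at h2
    omega
  obtain ⟨i, hi⟩ := Nat.exists_eq_succ_of_ne_zero hpos
  have h1 := Nat.find_spec hex
  have h2 := Nat.find_min hex (show i < Nat.find hex by omega)
  rw [hi] at h1 hle
  have h3 := hstep i hle
  refine ⟨i, ⟨hle, by simp only [Nat.succ_eq_add_one] at h1; constructor <;> omega⟩, ?_⟩
  rintro j ⟨hj, hj1, hj2⟩
  rcases lt_trichotomy i j with h | h | h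
  · have := hmono (show i + 1 ≤ j from h)
    simp only [Nat.succ_eq_add_one] at h1 this
    omega
  · exact h.symm
  · have := hmono (show j + 1 ≤ i from h)
    simp only at this
    omega

/-- The heart of the recursion: as `finrank T < s ≤ a + b`, one of the two factors always cancels
while the other is held constant. -/
theorem sum_isJump_eq_zero {f g : Submodule (ZMod 2) V → ℂ} {k l i a b s : ℕ}
    {F : ℕ → Submodule (ZMod 2) V} (hF : Monotone F)
    (hdim : ∀ i ≤ finrank (ZMod 2) V, finrank (ZMod 2) (F i) = i)
    (hi : i < finrank (ZMod 2) V) (hl : l < k) (hab : s ≤ a + b)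
    (hf : ∀ T, T ≤ F i → finrank (ZMod 2) T < a → sumBetween f l T (F i) = 0)
    (hg : ∀ T, F (i + 1) ≤ T → finrank (ZMod 2) T < b + (i + 1) →
      sumBetween g (k - l - 1 + (i + 1)) T ⊤ = 0)
    {T : Submodule (ZMod 2) V} (hT : finrank (ZMod 2) T < s) :
    ∑ B ∈ finsetOf (fun B : Submodule (ZMod 2) V => T ≤ B ∧ finrank (ZMod 2) B = k ∧
      IsJump F l i B), f (B ⊓ F i) * g (B ⊔ F (i + 1)) = 0 := by
  classical
  have hFi := hF i.le_succ
  rw [Nat.succ_eq_add_one] at hFi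
  have hd1 := hdim i hi.le
  have hd2 := hdim (i + 1) hi
  have hin := fun B : Submodule (ZMod 2) V => Submodule.finrank_sup_add_finrank_inf_eq B (F i)
  have hin' := fun B : Submodule (ZMod 2) V => Submodule.finrank_sup_add_finrank_inf_eq B (F (i + 1))
  by_cases hTa : finrank (ZMod 2) (T ⊓ F i : Submodule (ZMod 2) V) < a
  -- Group by `P = B ⊔ F i`. At a jump this equals `B ⊔ F (i + 1)`, so the factor `g` is constant on
  -- each group and `f` cancels.
  · rw [← Finset.sum_fiberwise_of_maps_to (t := finsetOf fun _ => True)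
      (g := fun B => B ⊔ F i) fun _ _ => mem_finsetOf.2 trivial]
    refine Finset.sum_eq_zero fun P _ => ?_
    by_cases hP : F (i + 1) ≤ P ∧ finrank (ZMod 2) P + l = k + i
    · have h := sum_inf_eq_zero (k := k) (P := P) (hf _ inf_le_right hTa)
      rw [← mul_zero (g P), ← h, Finset.mul_sum]
      refine Finset.sum_congr ?_ ?_
      · ext B
        simp only [Finset.mem_filter, mem_finsetOf]
        constructor
        · rintro ⟨⟨h1, h2, h3, h4⟩, h5⟩
          exact ⟨h1, h2, h3, h5⟩
        · rintro ⟨h1, h2, h3, h5⟩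
          refine ⟨⟨h1, h2, h3, ?_⟩, h5⟩
          have h6 : B ⊔ F (i + 1) = P := by
            refine le_antisymm (sup_le (by rw [← h5]; exact le_sup_left) hP.1) ?_
            rw [← h5]
            exact sup_le_sup_left hFi B
          have h7 := hin' B
          rw [h6] at h7
          omega
      · intro B hB
        rw [mem_finsetOf] at hB
        have h6 : B ⊔ F (i + 1) = P := by
          refine le_antisymm (sup_le (by rw [← hB.2.2.2]; exact le_sup_left) hP.1) ?_
          rw [← hB.2.2.2]
          exact sup_le_sup_left hFi B
        rw [h6, mul_comm]
    · refine Finset.sum_eq_zero fun B hB => absurd ?_ hP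
      simp only [Finset.mem_filter, mem_finsetOf] at hB
      obtain ⟨⟨h1, h2, h3, h4⟩, h5⟩ := hB
      have h7 := hin' B
      have h8 := hin B
      have h9 : B ⊔ F i = B ⊔ F (i + 1) :=
        Submodule.eq_of_le_of_finrank_eq (sup_le_sup_left hFi B) (by omega)
      constructor
      · rw [← h5, h9]
        exact le_sup_right
      · rw [← h5]
        omega
  -- Group by `N = B ⊓ F (i + 1)`, which determines `B ⊓ F i`, so the factor `f` is constant and `g`
  -- cancels.
  · rw [← Finset.sum_fiberwise_of_maps_to (t := finsetOf fun _ => True)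
      (g := fun B => B ⊓ F (i + 1)) fun _ _ => mem_finsetOf.2 trivial]
    refine Finset.sum_eq_zero fun N _ => ?_
    have hNi : ∀ B, B ⊓ F (i + 1) = N → B ⊓ F i = N ⊓ F i := by
      rintro B rfl
      rw [inf_assoc, inf_eq_right.2 hFi]
    by_cases hN : finrank (ZMod 2) N = l + 1 ∧ finrank (ZMod 2) (N ⊓ F i : Submodule (ZMod 2) V) = l
    -- Here `T ⊓ F i` has dimension at least `a`, so joining `F (i + 1)` to `T` adds at most
    -- `finrank T - a < b` to its dimension `i + 1`.
    · have hTb : finrank (ZMod 2) (T ⊔ F (i + 1) : Submodule (ZMod 2) V) < b + (i + 1) := by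
        have h1 := hin' T
        have h2 : finrank (ZMod 2) (T ⊓ F i : Submodule (ZMod 2) V) ≤
          finrank (ZMod 2) (T ⊓ F (i + 1) : Submodule (ZMod 2) V) :=
          Submodule.finrank_mono (inf_le_inf_left T hFi)
        omega
      have h := sum_sup_eq_zero (k := k) (N := N) (hg _ le_sup_right hTb)
      rw [← mul_zero (f (N ⊓ F i)), ← h, Finset.mul_sum]
      refine Finset.sum_congr ?_ ?_
      · ext B
        simp only [Finset.mem_filter, mem_finsetOf]
        have h7 := hin' B
        constructor
        · rintro ⟨⟨h1, h2, h3, h4⟩, h5⟩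
          exact ⟨h1, h2, by omega, h5⟩
        · rintro ⟨h1, h2, h3, h5⟩
          refine ⟨⟨h1, h2, ?_, ?_⟩, h5⟩
          · rw [hNi B h5]
            exact hN.2
          · rw [h5]
            exact hN.1
      · intro B hB
        rw [mem_finsetOf] at hB
        rw [hNi B hB.2.2.2]
    · refine Finset.sum_eq_zero fun B hB => absurd ?_ hN
      simp only [Finset.mem_filter, mem_finsetOf] at hB
      obtain ⟨⟨h1, h2, h3, h4⟩, h5⟩ := hB
      rw [← hNi B h5, h3, ← h5, h4]
      exact ⟨rfl, rfl⟩

theorem hasNull_of_flag {k l s : ℕ} {a b : ℕ → ℕ} (hl : l < k)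
    (hab : ∀ i < finrank (ZMod 2) V, s ≤ a i + b i)
    (ha : ∀ i < finrank (ZMod 2) V, HasNull (Fin i → ZMod 2) l (a i))
    (hb : ∀ i < finrank (ZMod 2) V,
      HasNull (Fin (finrank (ZMod 2) V - 1 - i) → ZMod 2) (k - l - 1) (b i)) :
    HasNull V k s := by
  classical
  obtain ⟨F, hF, hdim⟩ := exists_flag V
  have ha' : ∀ i < finrank (ZMod 2) V, ∃ g : Submodule (ZMod 2) V → ℂ, (∀ B, g B ^ 3 = 1) ∧
      ∀ T, T ≤ F i → finrank (ZMod 2) T < a i → sumBetween g l T (F i) = 0 := fun i hi =>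
    ((ha i hi).of_finrank_eq (by rw [finrank_fin_fun, hdim i hi.le])).exists_below
  have hb' : ∀ i < finrank (ZMod 2) V, ∃ g : Submodule (ZMod 2) V → ℂ, (∀ B, g B ^ 3 = 1) ∧
      ∀ T, F (i + 1) ≤ T → finrank (ZMod 2) T < b i + (i + 1) →
      sumBetween g (k - l - 1 + (i + 1)) T ⊤ = 0 := fun i hi => by
    have h1 := Submodule.finrank_quotient_add_finrank (F (i + 1))
    have h2 := hdim (i + 1) hi
    have h := ((hb i hi).of_finrank_eq (W := V ⧸ F (i + 1))
      (by rw [finrank_fin_fun]; omega)).exists_above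
    rwa [h2] at h
  choose! f hf1 hf2 using ha'
  choose! g hg1 hg2 using hb'
  -- The product has exactly one factor when `finrank B > l`. It is empty otherwise, with the
  -- harmless value 1.
  refine ⟨fun B => ∏ i ∈ Finset.range (finrank (ZMod 2) V) with IsJump F l i B,
    f i (B ⊓ F i) * g i (B ⊔ F (i + 1)), fun B => ?_, fun T hT => ?_⟩
  · rw [← Finset.prod_pow]
    refine Finset.prod_eq_one fun i hi => ?_
    have hi' := Finset.mem_range.1 (Finset.mem_filter.1 hi).1
    rw [mul_pow, hf1 i hi', hg1 i hi', one_mul]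
  · unfold sumBetween
    have hJ : ∀ B ∈ finsetOf fun B : Submodule (ZMod 2) V =>
        T ≤ B ∧ B ≤ ⊤ ∧ finrank (ZMod 2) B = k,
        ∃! i, i < finrank (ZMod 2) V ∧ IsJump F l i B := fun B hB =>
      existsUnique_isJump hF hdim (by rw [mem_finsetOf] at hB; omega)
    rw [sum_eq_sum_of_partition _ hJ]
    refine Finset.sum_eq_zero fun i hi => ?_
    have hi' := Finset.mem_range.1 hi
    rw [← sum_isJump_eq_zero hF hdim hi' hl (hab i hi') (hf2 i hi') (hg2 i hi') hT]
    refine Finset.sum_congr ?_ ?_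
    · ext B
      simp only [Finset.mem_filter, mem_finsetOf, le_top, true_and, and_assoc]
    · intro B hB
      rw [mem_finsetOf] at hB
      have huniq := existsUnique_isJump hF hdim (l := l) (B := B) (by omega)
      have : (Finset.range (finrank (ZMod 2) V)).filter (fun i => IsJump F l i B) = {i} := by
        ext j
        simp only [Finset.mem_filter, Finset.mem_range, Finset.mem_singleton]
        constructor
        · intro hj
          exact huniq.unique hj ⟨hi', hB.2.2⟩
        · rintro rfl
          exact ⟨hi', hB.2.2⟩
      rw [this, Finset.prod_singleton]

/-- Split the `(k + 1)`-subspaces by whether they contain `p`. Modulo `p` the first kind has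
dimension `k`, the second `k + 1`, and on each kind the map to the quotient has fibres of constant
size above a given `T`. -/
theorem HasNull.pascal {k s : ℕ} {p : V} (hp : p ≠ 0)
    (h1 : HasNull (V ⧸ span (ZMod 2) {p}) k s) (h2 : HasNull (V ⧸ span (ZMod 2) {p}) (k + 1) s) :
    HasNull V (k + 1) s := by
  classical
  set U := span (ZMod 2) {p} with hU
  have hUdim : finrank (ZMod 2) U = 1 := finrank_span_singleton hp
  obtain ⟨f, hf1, hf2⟩ := h1.exists_above
  obtain ⟨g, hg1, hg2⟩ := h2.exists_above
  rw [hUdim] at hf2 hg2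
  refine ⟨fun B => if U ≤ B then f (B ⊔ U) else g (B ⊔ U), fun B => ?_, fun T hT => ?_⟩
  · dsimp only
    split_ifs
    · exact hf1 _
    · exact hg1 _
  · have hTU : finrank (ZMod 2) (T ⊔ U : Submodule (ZMod 2) V) < s + 1 := by
      have := Submodule.finrank_sup_add_finrank_inf_eq T U
      omega
    have hdis : ∀ B : Submodule (ZMod 2) V, ¬ U ≤ B ↔ B ⊓ U = ⊥ := by
      intro B
      constructor
      · intro h
        have h3 := Submodule.finrank_lt_finrank_of_lt (inf_lt_right.2 h)
        rw [hUdim] at h3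
        exact Submodule.finrank_eq_zero.1 (by omega)
      · intro h h3
        rw [inf_eq_right.2 h3] at h
        rw [h, finrank_bot] at hUdim
        omega
    unfold sumBetween
    rw [Finset.sum_ite]
    have e1 := sum_sup_eq_zero (k := k + 1) (N := U) (hf2 _ le_sup_right hTU)
    have e2 := sum_sup_eq_zero (k := k + 1) (N := ⊥) (hg2 _ le_sup_right hTU)
    rw [← add_zero (0 : ℂ)]
    refine congrArg₂ (· + ·) (Eq.trans (Finset.sum_congr ?_ fun _ _ => rfl) e1)
      (Eq.trans (Finset.sum_congr ?_ fun _ _ => rfl) e2)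
    · ext B
      simp only [Finset.mem_filter, mem_finsetOf, le_top, true_and]
      have h3 := Submodule.finrank_sup_add_finrank_inf_eq B U
      constructor
      · rintro ⟨⟨h4, h5⟩, h6⟩
        rw [sup_eq_left.2 h6, inf_eq_right.2 h6]
        exact ⟨h4, h5, h5, rfl⟩
      · rintro ⟨h4, h5, h6, h7⟩
        exact ⟨⟨h4, h5⟩, inf_eq_right.1 h7⟩
    · ext B
      simp only [Finset.mem_filter, mem_finsetOf, le_top, true_and, hdis]
      have h3 := Submodule.finrank_sup_add_finrank_inf_eq B U
      constructor
      · rintro ⟨⟨h4, h5⟩, h6⟩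
        rw [h6, finrank_bot] at h3
        exact ⟨h4, h5, by omega, h6⟩
      · rintro ⟨h4, h5, h6, h7⟩
        exact ⟨⟨h4, h5⟩, h7⟩

end

/-! ### Recursion on the residues modulo 6 -/

theorem hasNull_fin_dual {v k s : ℕ} (hk : k ≤ v) (h : HasNull (Fin v → ZMod 2) k s) :
    HasNull (Fin v → ZMod 2) (v - k) s := by
  have h1 := h.dual (by rwa [finrank_fin_fun])
  rw [finrank_fin_fun] at h1
  exact h1.of_finrank_eq Subspace.dual_finrank_eq

theorem exists_finrank_quotient_span (v : ℕ) : ∃ p : Fin (v + 1) → ZMod 2, p ≠ 0 ∧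
    finrank (ZMod 2) ((Fin (v + 1) → ZMod 2) ⧸ span (ZMod 2) {p}) = v := by
  refine ⟨1, one_ne_zero, ?_⟩
  have h := Submodule.finrank_quotient_add_finrank (span (ZMod 2) {(1 : Fin (v + 1) → ZMod 2)})
  rw [finrank_fin_fun, finrank_span_singleton one_ne_zero] at h
  omega

theorem hasNull_fin_derived {v k s : ℕ} (h : HasNull (Fin (v + 1) → ZMod 2) (k + 1) (s + 1)) :
    HasNull (Fin v → ZMod 2) k s := by
  obtain ⟨p, hp, hdim⟩ := exists_finrank_quotient_span v
  have h1 := finrank_span_singleton (K := ZMod 2) hp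
  exact (HasNull.quotient (k := k) (s := s) (span (ZMod 2) {p})
    (by rw [h1]; exact h)).of_finrank_eq (by rw [hdim, finrank_fin_fun])

theorem hasNull_fin_pascal {v k s : ℕ} (h1 : HasNull (Fin v → ZMod 2) k s)
    (h2 : HasNull (Fin v → ZMod 2) (k + 1) s) : HasNull (Fin (v + 1) → ZMod 2) (k + 1) s := by
  obtain ⟨p, hp, hdim⟩ := exists_finrank_quotient_span v
  exact HasNull.pascal hp (h1.of_finrank_eq (by rw [hdim, finrank_fin_fun]))
    (h2.of_finrank_eq (by rw [hdim, finrank_fin_fun]))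

/-- The strength obtained in dimension `v` for subspaces of dimension `k`, shifted by one. -/
def nullLevel (v k : ℕ) : ℕ :=
  if v % 6 < k % 6 then min (v % 6 + 1) 3 else 0

/-- Each quotient by a point lowers dimension, `k` and level by one: dimension 8 has level 3,
dimension 7 level 2, dimension 6 level 1. Dimensions 9 and 10 come from Pascal steps, which keep
level 3. -/
theorem hasNull_nullLevel_small (h3 : HasNull (Fin 8 → ZMod 2) 3 3)
    (h4 : HasNull (Fin 8 → ZMod 2) 4 3) {v k : ℕ} (hv : 6 ≤ v) (hv' : v ≤ 10) (hk : v % 6 < k)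
    (hk' : k ≤ 5) : HasNull (Fin v → ZMod 2) k (min (v % 6 + 1) 3) := by
  have h5 : HasNull (Fin 8 → ZMod 2) 5 3 := hasNull_fin_dual (v := 8) (k := 3) (by norm_num) h3
  have h72 := hasNull_fin_derived h3
  have h73 := hasNull_fin_derived h4
  have h74 := hasNull_fin_derived h5
  have h75 := hasNull_fin_dual (v := 7) (k := 2) (by norm_num) h72
  have h61 := hasNull_fin_derived h72
  have h62 := hasNull_fin_derived h73
  have h63 := hasNull_fin_derived h74
  have h64 := hasNull_fin_dual (v := 6) (k := 2) (by norm_num) h62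
  have h65 := hasNull_fin_dual (v := 6) (k := 1) (by norm_num) h61
  have h94 := hasNull_fin_pascal h3 h4
  have h95 := hasNull_fin_pascal h4 h5
  have h105 := hasNull_fin_pascal h94 h95
  interval_cases v <;> simp only [Nat.reduceMod] at hk <;> interval_cases k <;> assumption

theorem hasNull_nullLevel (h3 : HasNull (Fin 8 → ZMod 2) 3 3)
    (h4 : HasNull (Fin 8 → ZMod 2) 4 3) (v : ℕ) :
    ∀ k, HasNull (Fin v → ZMod 2) k (nullLevel v k) := by
  induction v using Nat.strong_induction_on with
  | _ v ih =>
    have hlarge : ∀ k, v % 6 < k % 6 → 6 ≤ k →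
        HasNull (Fin v → ZMod 2) k (min (v % 6 + 1) 3) := by
      intro k hk hk6
      have hf : finrank (ZMod 2) (Fin v → ZMod 2) = v := finrank_fin_fun _
      -- With `l = 5` the two factors concern 5-subspaces and `(k - 6)`-subspaces, so `k` keeps its
      -- residue. Let `r = i % 6`. If `r < v % 6`, the uncapped levels `r + 1` and `v % 6 - r` add
      -- up to `v % 6 + 1`; if `v % 6 ≤ r ≤ 4`, the first level suffices alone; if `r = 5`, the
      -- second does.
      refine hasNull_of_flag (l := 5) (a := fun i => nullLevel i 5)
        (b := fun i => nullLevel (v - 1 - i) (k - 5 - 1)) hk6 ?_ ?_ ?_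
      · rw [hf]
        intro i hi
        unfold nullLevel
        have h1 : (k - 5 - 1) % 6 = k % 6 := by omega
        have h2 : i % 6 < v % 6 → (v - 1 - i) % 6 = v % 6 - 1 - i % 6 := by omega
        have h3 : i % 6 = 5 → (v - 1 - i) % 6 = v % 6 := by omega
        rw [h1]
        split_ifs <;> omega
      · rw [hf]
        exact fun i hi => ih i hi 5
      · rw [hf]
        exact fun i hi => ih _ (by omega) _
    intro k
    unfold nullLevel
    split_ifs with hk
    swap
    · exact hasNull_zero k
    by_cases hkv : v < k
    · exact hasNull_of_finrank_lt _ (by rwa [finrank_fin_fun])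
    by_cases hk6 : 6 ≤ k
    · exact hlarge k hk hk6
    by_cases hvk : 6 ≤ v - k
    -- Duality keeps the condition: `(v - k) % 6 = v % 6 + 6 - k % 6`, which exceeds `v % 6`.
    · have h := hasNull_fin_dual (Nat.sub_le v k) (hlarge (v - k) (by omega) hvk)
      rwa [Nat.sub_sub_self (by omega)] at h
    · exact hasNull_nullLevel_small h3 h4 (by omega) (by omega) (by omega) (by omega)

/-! ### From null functions to large sets -/

/-- A primitive cube root of unity. -/
noncomputable def cubeRoot : ℂ := ⟨-(1 / 2), √3 / 2⟩

theorem cubeRoot_sq : cubeRoot ^ 2 = -1 - cubeRoot := by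
  have h3 : √3 * √3 = 3 := Real.mul_self_sqrt (by norm_num)
  apply Complex.ext
  · simp only [pow_two, cubeRoot, Complex.mul_re, Complex.sub_re, Complex.neg_re, Complex.one_re]
    linear_combination -h3 / 4
  · simp only [pow_two, cubeRoot, Complex.mul_im, Complex.sub_im, Complex.neg_im, Complex.one_im]
    ring

theorem cubeRoot_pow_three : cubeRoot ^ 3 = 1 := by
  linear_combination (cubeRoot - 1) * cubeRoot_sq

theorem exists_pow_eq_of_pow_three {z : ℂ} (hz : z ^ 3 = 1) : ∃ i : Fin 3, z = cubeRoot ^ (i : ℕ) := by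
  have h : (z - 1) * ((z - cubeRoot) * (z - cubeRoot ^ 2)) = 0 := by
    linear_combination hz + (z - z ^ 2) * cubeRoot_sq + (z - 1) * cubeRoot_pow_three
  rcases mul_eq_zero.1 h with h | h
  · exact ⟨0, by simpa using sub_eq_zero.1 h⟩
  rcases mul_eq_zero.1 h with h | h
  · exact ⟨1, by simpa using sub_eq_zero.1 h⟩
  · exact ⟨2, by simpa using sub_eq_zero.1 h⟩

theorem nat_eq_of_add_cubeRoot {a b c : ℕ}
    (h : (a : ℂ) + b * cubeRoot + c * cubeRoot ^ 2 = 0) : a = c ∧ b = c := by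
  rw [cubeRoot_sq] at h
  have h1 := congrArg Complex.im h
  have h2 := congrArg Complex.re h
  simp [cubeRoot] at h1 h2
  have h3 : (√3 : ℝ) ≠ 0 := by positivity
  have hbc : (b : ℝ) = c := by
    have : √3 * ((b : ℝ) - c) = 0 := by linear_combination 2 * h1
    exact sub_eq_zero.1 ((mul_eq_zero.1 this).resolve_left h3)
  refine ⟨?_, by exact_mod_cast hbc⟩
  have : (a : ℝ) = c := by linear_combination h2 + hbc / 2
  exact_mod_cast this

section
variable {V : Type*} [AddCommGroup V] [Module (ZMod 2) V] [Finite V]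

theorem sumBetween_eq_sum_card {f : Submodule (ZMod 2) V → ℂ} {c : Submodule (ZMod 2) V → Fin 3}
    (hc : ∀ B, f B = cubeRoot ^ (c B : ℕ)) (k : ℕ) (T : Submodule (ZMod 2) V) :
    sumBetween f k T ⊤ = ∑ i : Fin 3, ((finsetOf fun B : Submodule (ZMod 2) V =>
      T ≤ B ∧ finrank (ZMod 2) B = k ∧ c B = i).card : ℂ) * cubeRoot ^ (i : ℕ) := by
  classical
  unfold sumBetween
  rw [← Finset.sum_fiberwise (g := c)]
  refine Finset.sum_congr rfl fun i _ => ?_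
  rw [← nsmul_eq_mul, ← Finset.sum_const]
  refine Finset.sum_congr ?_ ?_
  · ext B
    simp only [Finset.mem_filter, mem_finsetOf, le_top, true_and, and_assoc]
  · intro B hB
    rw [mem_finsetOf] at hB
    rw [hc, hB.2.2]

theorem card_superspaces_eq {k : ℕ} {T T' : Submodule (ZMod 2) V}
    (h : finrank (ZMod 2) T = finrank (ZMod 2) T') :
    (finsetOf fun B : Submodule (ZMod 2) V => T ≤ B ∧ finrank (ZMod 2) B = k).card ≤
      (finsetOf fun B : Submodule (ZMod 2) V => T' ≤ B ∧ finrank (ZMod 2) B = k).card := by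
  obtain ⟨φ, -, hφ⟩ := exists_linearEquiv_fix_map (bot_le : ⊥ ≤ T) (bot_le : ⊥ ≤ T') h
  refine Finset.card_le_card_of_injOn (fun B => B.map φ.toLinearMap) ?_
    (Submodule.map_injective_of_injective φ.injective).injOn
  intro B hB
  rw [Finset.mem_coe, mem_finsetOf] at hB ⊢
  exact ⟨hφ ▸ Submodule.map_mono hB.1, (LinearEquiv.finrank_map_eq φ B).trans hB.2⟩

theorem exists_isLargeSet_of_hasNull {k t : ℕ} (hk : k ≤ finrank (ZMod 2) V)
    (h : HasNull V k (t + 1)) :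
    ∃ 𝓑 : Fin 3 → Set (Submodule (ZMod 2) V), IsLargeSet 3 t k (finrank (ZMod 2) V) 𝓑 := by
  classical
  obtain ⟨f, h1, h2⟩ := h
  choose c hc using fun B => exists_pow_eq_of_pow_three (h1 B)
  let N : Submodule (ZMod 2) V → Fin 3 → ℕ := fun T i =>
    (finsetOf fun B : Submodule (ZMod 2) V => T ≤ B ∧ finrank (ZMod 2) B = k ∧ c B = i).card
  have hN : ∀ T : Submodule (ZMod 2) V, finrank (ZMod 2) T < t + 1 → ∀ i, N T i = N T 2 := by
    intro T hT
    have h3 := h2 T hT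
    rw [sumBetween_eq_sum_card hc, Fin.sum_univ_three] at h3
    have h4 := nat_eq_of_add_cubeRoot (a := N T 0) (b := N T 1) (c := N T 2) (by simpa [N] using h3)
    intro i
    fin_cases i
    exacts [h4.1, h4.2, rfl]
  have htot : ∀ T : Submodule (ZMod 2) V, (finsetOf fun B : Submodule (ZMod 2) V => T ≤ B ∧ finrank (ZMod 2) B = k).card =
      ∑ i, N T i := by
    intro T
    rw [Finset.card_eq_sum_card_fiberwise (f := c) (t := Finset.univ) fun _ _ => Finset.mem_univ _]
    refine Finset.sum_congr rfl fun i _ => ?_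
    congr 1
    ext B
    simp only [Finset.mem_filter, mem_finsetOf, and_assoc]
  have hcount : ∀ (T : Submodule (ZMod 2) V) i, {B ∈ {B : Submodule (ZMod 2) V | finrank (ZMod 2) B = k ∧ c B = i} | T ≤ B}.ncard = N T i := by
    intro T i
    rw [Set.ncard_eq_toFinset_card _ (Set.toFinite _)]
    congr 1
    ext B
    simp only [Set.Finite.mem_toFinset, Set.mem_ofPred_eq, mem_finsetOf]
    tauto
  refine ⟨fun i => {B : Submodule (ZMod 2) V | finrank (ZMod 2) B = k ∧ c B = i}, ?_, ?_, ?_, ?_⟩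
  · intro i
    -- Balance above `⊥` makes the three classes equal in size, and some `k`-subspace exists, so
    -- none is empty.
    have h3 := htot ⊥
    have h4 := hN ⊥ (by rw [finrank_bot]; omega)
    rw [Fin.sum_univ_three, h4 0, h4 1] at h3
    obtain ⟨F, hF, hdim⟩ := exists_flag V
    have h5 : 0 < (finsetOf fun B : Submodule (ZMod 2) V => ⊥ ≤ B ∧ finrank (ZMod 2) B = k).card :=
      Finset.card_pos.2 ⟨F k, mem_finsetOf.2 ⟨bot_le, hdim k hk⟩⟩
    have h6 : 0 < N ⊥ i := by
      rw [h4 i]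
      omega
    obtain ⟨B, hB⟩ := Finset.card_pos.1 h6
    exact ⟨B, (mem_finsetOf.1 hB).2⟩
  · intro i j hij
    rw [Set.disjoint_left]
    intro B hi hj
    exact hij (hi.2.symm.trans hj.2)
  · ext B
    simp [grassmannian]
  · by_cases hT₀ : ∃ T₀ : Submodule (ZMod 2) V, finrank (ZMod 2) T₀ = t
    · obtain ⟨T₀, hT₀⟩ := hT₀
      refine ⟨N T₀ 2, fun i => ⟨rfl, fun B hB => hB.1, fun T hT => ?_⟩⟩
      have hT' : finrank (ZMod 2) T = t := hT
      rw [hcount, hN T (by omega)]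
      -- The number of `k`-subspaces above `T` depends only on its dimension and is three times each
      -- colour count, so `l` is the same for all `T`.
      have h3 := (card_superspaces_eq (k := k) (hT'.trans hT₀.symm)).antisymm
        (card_superspaces_eq (hT₀.trans hT'.symm))
      rw [htot, htot, Fin.sum_univ_three, Fin.sum_univ_three, hN T (by omega) 0,
        hN T (by omega) 1, hN T₀ (by omega) 0, hN T₀ (by omega) 1] at h3
      omega
    -- Without `t`-subspaces the counting condition is vacuous, and 0 is an arbitrary value.
    · exact ⟨0, fun i => ⟨rfl, fun B hB => hB.1, fun T hT => absurd ⟨T, hT⟩ hT₀⟩⟩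

end

theorem exists_isLargeSet (h3 : HasNull (Fin 8 → ZMod 2) 3 3) (h4 : HasNull (Fin 8 → ZMod 2) 4 3)
    {v k : ℕ} (hkv : k ≤ v) (h : 2 ≤ v % 6 ∧ v % 6 < k % 6 ∧ k % 6 ≤ 5)
    (V : Type*) [AddCommGroup V] [Module (ZMod 2) V] [FiniteDimensional (ZMod 2) V]
    (hV : finrank (ZMod 2) V = v) :
    ∃ 𝓑 : Fin 3 → Set (Submodule (ZMod 2) V), IsLargeSet 3 2 k v 𝓑 := by
  have : Finite V := Module.finite_of_finite (ZMod 2)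
  have hlev : nullLevel v k = 2 + 1 := by
    unfold nullLevel
    rw [if_pos h.2.1]
    omega
  have hnull := hasNull_nullLevel h3 h4 v k
  rw [hlev] at hnull
  subst hV
  exact exists_isLargeSet_of_hasNull hkv (hnull.of_finrank_eq (finrank_fin_fun _))

/-! ### Vectors as binary numbers, and enumeration of small subspaces -/

/-- The natural numbers below `2 ^ n`, regarded as the vectors of their binary digits. -/
def Code (n : ℕ) : Type := {x : ℕ // x < 2 ^ n}

namespace Code
variable {n : ℕ}

@[ext]
theorem ext {a b : Code n} (h : a.1 = b.1) : a = b :=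
  Subtype.ext h

instance : Add (Code n) := ⟨fun a b => ⟨a.1 ^^^ b.1, Nat.xor_lt_two_pow a.2 b.2⟩⟩

instance : Zero (Code n) := ⟨⟨0, Nat.two_pow_pos n⟩⟩

instance : Neg (Code n) := ⟨fun a => a⟩

@[simp]
theorem val_add (a b : Code n) : (a + b).1 = a.1 ^^^ b.1 :=
  rfl

@[simp]
theorem val_zero : (0 : Code n).1 = 0 :=
  rfl

instance : AddCommGroup (Code n) where
  add_assoc a b c := ext (Nat.xor_assoc _ _ _)
  zero_add a := ext (Nat.zero_xor _)
  add_zero a := ext (Nat.xor_zero _)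
  neg_add_cancel a := ext (Nat.xor_self _)
  add_comm a b := ext (Nat.xor_comm _ _)
  nsmul := nsmulRec
  zsmul := zsmulRec

instance : Module (ZMod 2) (Code n) :=
  AddCommGroup.zmodModule fun x => by
    rw [two_nsmul]
    exact ext (Nat.xor_self _)

instance : Finite (Code n) :=
  inferInstanceAs (Finite {x : ℕ // x < 2 ^ n})

theorem finrank_eq (n : ℕ) : finrank (ZMod 2) (Code n) = n := by
  have h1 : Nat.card (Code n) = 2 ^ n := by
    have : Nat.card (Code n) = Nat.card (Fin (2 ^ n)) := Nat.card_congr Fin.equivSubtype.symm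
    rw [this, Nat.card_fin]
  have h2 := Module.natCard_eq_pow_finrank (K := ZMod 2) (V := Code n)
  rw [h1, Nat.card_eq_fintype_card, ZMod.card] at h2
  exact (Nat.pow_right_injective le_rfl h2).symm

end Code

section
variable {V : Type*} [AddCommGroup V] [Module (ZMod 2) V]

theorem add_self_of_zmod_two (x : V) : x + x = 0 := by
  rw [← two_smul (ZMod 2) x, show (2 : ZMod 2) = 0 from rfl, zero_smul]

theorem mem_sup_span_singleton_iff {B : Submodule (ZMod 2) V} {u z : V} :
    z ∈ B ⊔ span (ZMod 2) {u} ↔ z ∈ B ∨ z + u ∈ B := by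
  rw [Submodule.mem_sup]
  constructor
  · rintro ⟨b, hb, w, hw, rfl⟩
    obtain ⟨r, rfl⟩ := mem_span_singleton.1 hw
    have hr : r = 0 ∨ r = 1 := (show ∀ r : ZMod 2, r = 0 ∨ r = 1 by decide) r
    rcases hr with rfl | rfl
    · left
      simpa using hb
    · right
      rw [one_smul, add_assoc, add_self_of_zmod_two, add_zero]
      exact hb
  · rintro (h | h)
    · exact ⟨z, h, 0, zero_mem _, add_zero z⟩
    · refine ⟨z + u, h, u, mem_span_singleton_self u, ?_⟩
      rw [add_assoc, add_self_of_zmod_two, add_zero]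

theorem mem_span_pair_iff {u v z : V} :
    z ∈ span (ZMod 2) {u, v} ↔ z = 0 ∨ z = u ∨ z = v ∨ z = u + v := by
  have h : ∀ a b : V, a + b = 0 ↔ a = b := fun a b => by
    rw [add_eq_zero_iff_eq_neg, add_eq_zero_iff_neg_eq.1 (add_self_of_zmod_two b)]
  rw [span_insert, sup_comm, mem_sup_span_singleton_iff, ← bot_sup_eq (span (ZMod 2) {v}),
    mem_sup_span_singleton_iff, mem_sup_span_singleton_iff, mem_bot, mem_bot, mem_bot, mem_bot,
    h, h, h, eq_comm (b := u + v)]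
  have : z + u = v ↔ u + v = z := by
    rw [← h, ← h (u + v), add_assoc, add_comm]
  rw [this]
  tauto

variable [Finite V]

variable {W : Type*} [AddCommGroup W] [Module (ZMod 2) W] [Finite W]

/-- The superspaces of `T` correspond to the subspaces of a complement, here parametrised by `s`;
this is the modular law. -/
theorem sumBetween_eq_sum_of_isCompl (f : Submodule (ZMod 2) V → ℂ) {T : Submodule (ZMod 2) V}
    {s : W →ₗ[ZMod 2] V} (hs : Function.Injective s) (hT : IsCompl T (LinearMap.range s)) (k : ℕ) :
    sumBetween f (k + finrank (ZMod 2) T) T ⊤ =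
      ∑ D ∈ finsetOf (fun D : Submodule (ZMod 2) W => finrank (ZMod 2) D = k), f (T ⊔ D.map s) := by
  have h1 : ∀ D : Submodule (ZMod 2) W, (T ⊔ D.map s).comap s = D := by
    intro D
    refine le_antisymm ?_ (Submodule.map_le_iff_le_comap.1 le_sup_right)
    intro x hx
    obtain ⟨t, ht, _, ⟨d, hd, rfl⟩, h⟩ := Submodule.mem_sup.1 (Submodule.mem_comap.1 hx)
    have h2 : t = s (x - d) := by
      rw [map_sub, ← h, add_sub_cancel_right]
    have h3 := Submodule.disjoint_def.1 hT.disjoint t ht ⟨x - d, h2.symm⟩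
    rw [h3, eq_comm, map_eq_zero_iff s hs, sub_eq_zero] at h2
    rwa [h2]
  have h2 : ∀ B : Submodule (ZMod 2) V, T ≤ B → T ⊔ (B.comap s).map s = B := by
    intro B hB
    rw [Submodule.map_comap_eq, ← sup_inf_assoc_of_le _ hB, hT.sup_eq_top, top_inf_eq]
  have h3 : ∀ D : Submodule (ZMod 2) W, finrank (ZMod 2) (T ⊔ D.map s : Submodule (ZMod 2) V) =
      finrank (ZMod 2) D + finrank (ZMod 2) T := by
    intro D
    have h4 := Submodule.finrank_sup_add_finrank_inf_eq T (D.map s)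
    have h5 : T ⊓ D.map s = ⊥ :=
      (hT.disjoint.mono_right (LinearMap.map_le_range (f := s))).eq_bot
    have h6 := (Submodule.equivMapOfInjective s hs D).finrank_eq
    rw [h5, finrank_bot] at h4
    omega
  unfold sumBetween
  refine Finset.sum_nbij' (fun B => B.comap s) (fun D => T ⊔ D.map s) ?_ ?_ ?_ ?_ ?_
  · intro B hB
    simp only [mem_finsetOf, le_top, true_and] at hB ⊢
    have := h3 (B.comap s)
    rw [h2 B hB.1] at this
    omega
  · intro D hD
    simp only [mem_finsetOf, le_top, true_and] at hD ⊢
    exact ⟨le_sup_left, by rw [h3, hD]⟩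
  · intro B hB
    simp only [mem_finsetOf, le_top, true_and] at hB
    exact h2 B hB.1
  · intro D _
    exact h1 D
  · intro B hB
    simp only [mem_finsetOf, le_top, true_and] at hB
    simp only [h2 B hB.1]

theorem sum_finrank_one (f : Submodule (ZMod 2) V → ℂ) :
    ∑ D ∈ finsetOf (fun D : Submodule (ZMod 2) V => finrank (ZMod 2) D = 1), f D =
      ∑ v ∈ finsetOf (fun v : V => v ≠ 0), f (span (ZMod 2) {v}) := by
  symm
  refine Finset.sum_nbij (fun v => span (ZMod 2) {v}) ?_ ?_ ?_ fun _ _ => rfl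
  · intro v hv
    rw [mem_finsetOf] at hv ⊢
    exact finrank_span_singleton hv
  · intro v hv w hw h
    rw [Finset.mem_coe, mem_finsetOf] at hv hw
    have h1 : v ∈ span (ZMod 2) {w} := by
      simp only at h
      rw [← h]
      exact mem_span_singleton_self v
    rw [← Set.pair_eq_singleton, mem_span_pair_iff, add_self_of_zmod_two] at h1
    tauto
  · intro D hD
    rw [Finset.mem_coe, mem_finsetOf] at hD
    obtain ⟨v, hv, h⟩ := finrank_eq_one_iff'.1 hD
    refine ⟨v, ?_, ?_⟩
    · rw [Finset.mem_coe, mem_finsetOf]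
      simpa using hv
    · refine Submodule.eq_of_le_of_finrank_eq ((span_singleton_le_iff_mem _ _).2 v.2) ?_
      rw [hD]
      exact finrank_span_singleton (by simpa using hv)

theorem finrank_span_pair {u v : V} (hu : u ≠ 0) (hv : v ≠ 0) (huv : u ≠ v) :
    finrank (ZMod 2) (span (ZMod 2) {u, v}) = 2 := by
  rw [span_insert, finrank_sup_span_of_notMem, finrank_span_singleton hu]
  rw [← Set.pair_eq_singleton, mem_span_pair_iff, add_self_of_zmod_two]
  tauto

end

/-- A plane has three nonzero vectors, each the xor of the other two. Listing them in increasing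
order gives one basis per plane. -/
theorem Code.sum_finrank_two {n : ℕ} (f : Submodule (ZMod 2) (Code n) → ℂ) :
    ∑ D ∈ finsetOf (fun D : Submodule (ZMod 2) (Code n) => finrank (ZMod 2) D = 2), f D =
      ∑ v ∈ finsetOf (fun v : Code n × Code n => v.1.1 < v.2.1 ∧ v.2.1 < v.1.1 ^^^ v.2.1),
        f (span (ZMod 2) {v.1, v.2}) := by
  have hne : ∀ {u v : Code n}, u.1 < v.1 → v.1 < u.1 ^^^ v.1 → u ≠ 0 ∧ v ≠ 0 ∧ u ≠ v := by
    intro u v h1 h2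
    refine ⟨?_, ?_, ?_⟩
    · rintro rfl
      simp at h2
    · rintro rfl
      simp at h1
    · rintro rfl
      exact h1.false
  symm
  refine Finset.sum_nbij (fun v => span (ZMod 2) {v.1, v.2}) ?_ ?_ ?_ fun _ _ => rfl
  · rintro ⟨u, v⟩ h
    rw [mem_finsetOf] at h ⊢
    obtain ⟨h1, h2, h3⟩ := hne h.1 h.2
    exact finrank_span_pair h1 h2 h3
  · rintro ⟨u, v⟩ h ⟨u', v'⟩ h' heq
    rw [Finset.mem_coe, mem_finsetOf] at h h'
    simp only at h h' heq
    obtain ⟨h1, h2, -⟩ := hne h'.1 h'.2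
    have hu : u' ∈ span (ZMod 2) {u, v} := by
      rw [heq]
      exact subset_span (by simp)
    have hv : v' ∈ span (ZMod 2) {u, v} := by
      rw [heq]
      exact subset_span (by simp)
    rw [mem_span_pair_iff] at hu hv
    have e1 : u.1 ^^^ (u.1 ^^^ v.1) = v.1 := by
      rw [← Nat.xor_assoc, Nat.xor_self, Nat.zero_xor]
    have e2 : v.1 ^^^ (u.1 ^^^ v.1) = u.1 := by
      rw [Nat.xor_comm u.1, ← Nat.xor_assoc, Nat.xor_self, Nat.zero_xor]
    rcases hu with rfl | rfl | rfl | rfl <;> rcases hv with rfl | rfl | rfl | rfl <;>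
      first
      | exact absurd rfl h1
      | exact absurd rfl h2
      | rfl
      | omega
      | (simp only [Code.val_add, e1, e2] at h'; omega)
  · intro D hD
    rw [Finset.mem_coe, mem_finsetOf] at hD
    obtain ⟨u, hu, hu0⟩ := Submodule.exists_mem_ne_zero_of_ne_bot (p := D) (by
      rintro rfl
      rw [finrank_bot] at hD
      omega)
    obtain ⟨v, hv, hvu⟩ : ∃ v ∈ D, v ∉ span (ZMod 2) {u} := by
      by_contra! h
      have := Submodule.finrank_mono (show D ≤ span (ZMod 2) {u} from h)
      rw [finrank_span_singleton hu0] at this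
      omega
    have hv0 : v ≠ 0 := fun h => hvu (h ▸ zero_mem _)
    have huv : u ≠ v := fun h => hvu (h ▸ mem_span_singleton_self u)
    have huv0 : u + v ≠ 0 := fun h => huv (by
      have := congrArg (· + v) h
      rwa [add_assoc, add_self_of_zmod_two, add_zero, zero_add] at this)
    have key : ∀ a b : Code n, a ∈ D → b ∈ D → a.1 < b.1 → b.1 < (a + b).1 →
        D ∈ (fun v : Code n × Code n => span (ZMod 2) {v.1, v.2}) ''
          (finsetOf fun v : Code n × Code n => v.1.1 < v.2.1 ∧ v.2.1 < v.1.1 ^^^ v.2.1) := by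
      intro a b ha hb hab hab'
      refine ⟨(a, b), by rw [Finset.mem_coe, mem_finsetOf]; exact ⟨hab, hab'⟩, ?_⟩
      obtain ⟨h1, h2, h3⟩ := hne hab hab'
      refine Submodule.eq_of_le_of_finrank_eq ?_ ((finrank_span_pair h1 h2 h3).trans hD.symm)
      rw [span_le]
      rintro x (rfl | rfl)
      exacts [ha, hb]
    have hne' : ∀ {a b : Code n}, a ≠ b → a.1 ≠ b.1 := fun h h' => h (Code.ext h')
    have e1 : u + (u + v) = v := by rw [← add_assoc, add_self_of_zmod_two, zero_add]
    have e2 : v + (u + v) = u := by rw [add_comm u, ← add_assoc, add_self_of_zmod_two, zero_add]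
    have e3 : v + u = u + v := add_comm _ _
    have e4 : u + v + u = v := by rw [add_comm, e1]
    have e5 : u + v + v = u := by rw [add_comm, e2]
    have huv' := D.add_mem hu hv
    have n1 := hne' huv
    have n2 : u.1 ≠ (u + v).1 := hne' fun h => hv0 (by simpa using h)
    have n3 : v.1 ≠ (u + v).1 := hne' fun h => hu0 (by simpa using h)
    rcases lt_or_gt_of_ne n1 with h1 | h1 <;> rcases lt_or_gt_of_ne n2 with h2 | h2 <;>
      rcases lt_or_gt_of_ne n3 with h3 | h3
    · exact key u v hu hv h1 h3
    · exact key u (u + v) hu huv' h2 (by rwa [e1])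
    · omega
    · exact key (u + v) u huv' hu h2 (by rwa [e4])
    · exact key v u hv hu h1 (by rwa [e3])
    · omega
    · exact key v (u + v) hv huv' h3 (by rwa [e2])
    · exact key (u + v) v huv' hv h3 (by rwa [e5])

/-- The three colour counts are the base-8192 digits of a single number. With fewer than 8192 terms
there are no carries, so each count equals `m`. -/
theorem sum_cubeRoot_pow_eq_zero {α : Type*} {S : Finset α} {c : α → ℕ} {m : ℕ}
    (hc : ∀ e ∈ S, c e < 3) (hS : S.card < 8192)
    (h : ∑ e ∈ S, 8192 ^ c e = m * (1 + 8192 + 8192 ^ 2)) : ∑ e ∈ S, cubeRoot ^ c e = 0 := by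
  classical
  have hmaps : Set.MapsTo c S (Finset.range 3 : Finset ℕ) := fun e he => by
    rw [Finset.mem_coe, Finset.mem_range]
    exact hc e he
  have hcard := Finset.card_eq_sum_card_fiberwise hmaps
  have h1 : ∑ i ∈ Finset.range 3, (S.filter fun e => c e = i).card * 8192 ^ i =
      m * (1 + 8192 + 8192 ^ 2) := by
    rw [← h, ← Finset.sum_fiberwise_of_maps_to hmaps]
    refine Finset.sum_congr rfl fun i _ => ?_
    rw [Finset.sum_congr rfl fun e he => by rw [(Finset.mem_filter.1 he).2], Finset.sum_const,
      smul_eq_mul]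
  rw [← Finset.sum_fiberwise_of_maps_to hmaps]
  have h2 : ∀ i ∈ Finset.range 3, ∑ e ∈ S with c e = i, cubeRoot ^ c e =
      ((S.filter fun e => c e = i).card : ℂ) * cubeRoot ^ i := by
    intro i _
    rw [Finset.sum_congr rfl fun e he => by rw [(Finset.mem_filter.1 he).2], Finset.sum_const,
      nsmul_eq_mul]
  rw [Finset.sum_congr rfl h2]
  simp only [Finset.sum_range_succ, Finset.sum_range_zero, zero_add] at h1 hcard ⊢
  have h3 : (S.filter fun e => c e = 0).card = m ∧ (S.filter fun e => c e = 1).card = m ∧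
      (S.filter fun e => c e = 2).card = m := by
    have hm : m < 8192 := by omega
    have h0 : (S.filter fun e => c e = 0).card = m := by omega
    have h1 : (S.filter fun e => c e = 1).card = m := by omega
    omega
  rw [h3.1, h3.2.1, h3.2.2, cubeRoot_sq]
  ring

section
variable {V : Type*} [AddCommGroup V] [Module (ZMod 2) V] [Finite V]
  {W : Type*} [AddCommGroup W] [Module (ZMod 2) W] [Finite W]

theorem sum_mem_span_singleton {u : V} (hu : u ≠ 0) (a : V → ℕ) :
    ∑ z ∈ finsetOf (fun z => z ∈ span (ZMod 2) {u}), a z = a 0 + a u := by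
  classical
  have : (finsetOf fun z => z ∈ span (ZMod 2) {u}) = {0, u} := by
    ext z
    rw [mem_finsetOf, ← Set.pair_eq_singleton, mem_span_pair_iff, add_self_of_zmod_two]
    simp only [Finset.mem_insert, Finset.mem_singleton]
    tauto
  rw [this, Finset.sum_pair hu.symm]

theorem sum_mem_span_pair {u v : V} (hu : u ≠ 0) (hv : v ≠ 0) (huv : u ≠ v) (a : V → ℕ) :
    ∑ z ∈ finsetOf (fun z => z ∈ span (ZMod 2) {u, v}), a z =
      a 0 + a u + (a v + a (u + v)) := by
  classical
  have h0 : u + v ≠ 0 := fun h => huv (by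
    have := congrArg (· + v) h
    rwa [add_assoc, add_self_of_zmod_two, add_zero, zero_add] at this)
  have : (finsetOf fun z => z ∈ span (ZMod 2) {u, v}) = {0, u, v, u + v} := by
    ext z
    rw [mem_finsetOf, mem_span_pair_iff]
    simp only [Finset.mem_insert, Finset.mem_singleton]
  rw [this, Finset.sum_insert, Finset.sum_insert, Finset.sum_pair, add_assoc]
  · simpa using hu
  · simpa [huv] using hv
  · simpa using ⟨hu.symm, hv.symm, h0.symm⟩

theorem sum_mem_sup_map {T : Submodule (ZMod 2) V} {s : W →ₗ[ZMod 2] V}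
    (hs : Function.Injective s) (hT : Disjoint T (LinearMap.range s)) (D : Submodule (ZMod 2) W)
    (a : V → ℕ) :
    ∑ z ∈ finsetOf (fun z => z ∈ T ⊔ D.map s), a z =
      ∑ d ∈ finsetOf (fun d => d ∈ D), ∑ t ∈ finsetOf (fun t => t ∈ T), a (t + s d) := by
  rw [← Finset.sum_product']
  symm
  refine Finset.sum_nbij (fun e => e.2 + s e.1) ?_ ?_ ?_ fun _ _ => rfl
  · rintro ⟨d, t⟩ h
    rw [Finset.mem_product, mem_finsetOf, mem_finsetOf] at h
    rw [mem_finsetOf]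
    exact Submodule.add_mem_sup h.2 (Submodule.mem_map_of_mem h.1)
  · rintro ⟨d, t⟩ h ⟨d', t'⟩ h' heq
    simp only [Finset.coe_product, Set.mem_prod, Finset.mem_coe, mem_finsetOf] at h h' heq
    have h1 : t - t' = s (d' - d) := by
      rw [map_sub, sub_eq_sub_iff_add_eq_add, heq, add_comm]
    have h2 := Submodule.disjoint_def.1 hT _ (T.sub_mem h.2 h'.2) ⟨d' - d, h1.symm⟩
    have h3 := sub_eq_zero.1 h2
    rw [h2, eq_comm, map_eq_zero_iff s hs, sub_eq_zero] at h1
    rw [h1, h3]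
  · intro z hz
    rw [Finset.mem_coe, mem_finsetOf] at hz
    obtain ⟨t, ht, _, ⟨d, hd, rfl⟩, rfl⟩ := Submodule.mem_sup.1 hz
    refine ⟨(d, t), ?_, rfl⟩
    simp only [Finset.coe_product, Set.mem_prod, Finset.mem_coe, mem_finsetOf]
    exact ⟨hd, ht⟩

end

/-! ### Complements of planes by inserting zero digits -/

/-- Insertion of a zero digit at position `b` of the binary expansion of `n`. -/
def insertZero (b n : ℕ) : ℕ :=
  Nat.add (Nat.shiftLeft (Nat.shiftRight n b) (Nat.succ b)) (Nat.mod n (Nat.pow 2 b))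

theorem testBit_insertZero (b n j : ℕ) : (insertZero b n).testBit j =
    if j < b then n.testBit j else if j = b then false else n.testBit (j - 1) := by
  have h : insertZero b n = 2 ^ (b + 1) * (n >>> b) + n % 2 ^ b := by
    change (n >>> b) <<< (b + 1) + n % 2 ^ b = _
    rw [Nat.shiftLeft_eq, Nat.mul_comm]
  have hlt : n % 2 ^ b < 2 ^ (b + 1) :=
    (Nat.mod_lt _ (Nat.two_pow_pos b)).trans (Nat.pow_lt_pow_right (by norm_num) b.lt_succ_self)
  rw [h, Nat.testBit_two_pow_mul_add _ hlt, Nat.testBit_mod_two_pow, Nat.testBit_shiftRight]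
  rcases lt_trichotomy j b with h1 | h1 | h1
  · simp [h1, h1.trans b.lt_succ_self]
  · simp [h1]
  · rw [if_neg (by omega), if_neg (by omega), if_neg (by omega)]
    congr 1
    omega

theorem insertZero_xor (b m n : ℕ) :
    insertZero b (m ^^^ n) = insertZero b m ^^^ insertZero b n := by
  refine Nat.eq_of_testBit_eq fun j => ?_
  simp only [testBit_insertZero, Nat.testBit_xor]
  split_ifs <;> simp

theorem insertZero_lt {b m n : ℕ} (hb : b ≤ m) (hn : n < 2 ^ m) : insertZero b n < 2 ^ (m + 1) := by
  refine Nat.lt_pow_two_of_testBit _ fun j hj => ?_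
  rw [testBit_insertZero, if_neg (by omega), if_neg (by omega)]
  exact Nat.testBit_lt_two_pow (hn.trans_le (Nat.pow_le_pow_right (by norm_num) (by omega)))

theorem insertZero_eq_zero {b n : ℕ} (h : insertZero b n = 0) : n = 0 := by
  refine Nat.eq_of_testBit_eq fun j => ?_
  rw [Nat.zero_testBit]
  by_cases hj : j < b
  · have := testBit_insertZero b n j
    rw [h, Nat.zero_testBit, if_pos hj] at this
    exact this.symm
  · have := testBit_insertZero b n (j + 1)
    rw [h, Nat.zero_testBit, if_neg (by omega), if_neg (by omega)] at this
    exact this.symm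

/-- Insertion of zero digits at the final positions `p` and `q`. -/
def insertZeros (p q n : ℕ) : ℕ :=
  cond (Nat.ble p q) (insertZero q (insertZero p n)) (insertZero p (insertZero q n))

theorem insertZeros_xor (p q m n : ℕ) :
    insertZeros p q (m ^^^ n) = insertZeros p q m ^^^ insertZeros p q n := by
  unfold insertZeros
  cases Nat.ble p q <;> simp [insertZero_xor]

theorem insertZeros_lt {p q m n : ℕ} (hp : p < m + 2) (hq : q < m + 2) (hpq : p ≠ q)
    (hn : n < 2 ^ m) : insertZeros p q n < 2 ^ (m + 2) := by
  unfold insertZeros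
  cases h : Nat.ble p q
  · rw [← Bool.not_eq_true, Nat.ble_eq] at h
    exact insertZero_lt (by omega) (insertZero_lt (by omega) hn)
  · rw [Nat.ble_eq] at h
    exact insertZero_lt (by omega) (insertZero_lt (by omega) hn)

theorem insertZeros_eq_zero {p q n : ℕ} (h : insertZeros p q n = 0) : n = 0 := by
  unfold insertZeros at h
  cases h1 : Nat.ble p q
  · rw [h1] at h
    exact insertZero_eq_zero (insertZero_eq_zero h)
  · rw [h1] at h
    exact insertZero_eq_zero (insertZero_eq_zero h)

theorem testBit_insertZeros {p q : ℕ} (hpq : p ≠ q) (n : ℕ) :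
    (insertZeros p q n).testBit p = false ∧ (insertZeros p q n).testBit q = false := by
  unfold insertZeros
  cases h : Nat.ble p q
  · rw [← Bool.not_eq_true, Nat.ble_eq] at h
    rw [cond_false]
    constructor
    · rw [testBit_insertZero, if_neg (lt_irrefl _), if_pos rfl]
    · rw [testBit_insertZero, if_pos (by omega), testBit_insertZero, if_neg (lt_irrefl _),
        if_pos rfl]
  · rw [Nat.ble_eq] at h
    rw [cond_true]
    constructor
    · rw [testBit_insertZero, if_pos (by omega), testBit_insertZero, if_neg (lt_irrefl _),
        if_pos rfl]
    · rw [testBit_insertZero, if_neg (lt_irrefl _), if_pos rfl]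

namespace Code

/-- Insertion of two zero digits as a linear map. -/
def insertLinear {m : ℕ} (p q : Fin (m + 2)) (hpq : p ≠ q) : Code m →ₗ[ZMod 2] Code (m + 2) :=
  AddMonoidHom.toZModLinearMap 2
    { toFun := fun u => ⟨insertZeros p q u.1,
        insertZeros_lt p.2 q.2 (fun h => hpq (Fin.ext h)) u.2⟩
      map_zero' := Code.ext (by
        have h := insertZeros_xor p q 0 0
        simpa using h)
      map_add' := fun u v => Code.ext (insertZeros_xor p q u.1 v.1) }

@[simp]
theorem val_insertLinear {m : ℕ} (p q : Fin (m + 2)) (hpq : p ≠ q) (u : Code m) :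
    (insertLinear p q hpq u).1 = insertZeros p q u.1 :=
  rfl

theorem insertLinear_injective {m : ℕ} (p q : Fin (m + 2)) (hpq : p ≠ q) :
    Function.Injective (insertLinear p q hpq) := by
  rw [injective_iff_map_eq_zero]
  intro u hu
  exact Code.ext (insertZeros_eq_zero (congrArg Subtype.val hu))

/-- The digits at `p` and `q` of `x` and `y` form a triangular matrix with unit diagonal, so only
the zero vector of the plane has both digits zero. -/
theorem isCompl_span_pair_range {m : ℕ} {p q : Fin (m + 2)} (hpq : p ≠ q) {x y : Code (m + 2)}
    (hxp : x.1.testBit p = true) (hyp : y.1.testBit p = false) (hyq : y.1.testBit q = true) :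
    IsCompl (span (ZMod 2) {x, y}) (LinearMap.range (insertLinear p q hpq)) := by
  have hpq' : (p : ℕ) ≠ q := fun h => hpq (Fin.ext h)
  have hdis : Disjoint (span (ZMod 2) {x, y}) (LinearMap.range (insertLinear p q hpq)) := by
    rw [Submodule.disjoint_def]
    rintro _ hz ⟨u, rfl⟩
    obtain ⟨h1, h2⟩ := testBit_insertZeros hpq' u.1
    rw [← val_insertLinear p q hpq] at h1 h2
    rw [mem_span_pair_iff] at hz
    rcases hz with h | h | h | h
    · exact h
    · rw [h, hxp] at h1
      exact absurd h1 (by simp)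
    · rw [h, hyq] at h2
      exact absurd h2 (by simp)
    · rw [h, val_add, Nat.testBit_xor, hxp, hyp] at h1
      exact absurd h1 (by simp)
  refine ⟨hdis, ?_⟩
  have hx : x ≠ 0 := by
    rintro rfl
    simp at hxp
  have hy : y ≠ 0 := by
    rintro rfl
    simp at hyq
  have hxy : x ≠ y := by
    rintro rfl
    rw [hxp] at hyp
    exact absurd hyp (by simp)
  have h1 := Submodule.finrank_sup_add_finrank_inf_eq (span (ZMod 2) {x, y})
    (LinearMap.range (insertLinear p q hpq))
  rw [hdis.eq_bot, finrank_bot, finrank_span_pair hx hy hxy,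
    LinearMap.finrank_range_of_inj (insertLinear_injective p q hpq), finrank_eq] at h1
  rw [codisjoint_iff]
  exact Submodule.eq_top_of_finrank_eq (by rw [finrank_eq]; omega)

end Code

/-! ### Orbit colourings and their computable check -/

/-- The `i`-th digit of `t` in base `2 ^ w`. -/
def lookup (w t i : ℕ) : ℕ :=
  Nat.mod (Nat.shiftRight t (Nat.mul w i)) (Nat.pow 2 w)

/-- The sum of the first `n` values of `f`. -/
def sumTo (f : ℕ → ℕ) (n : ℕ) : ℕ :=
  Nat.rec 0 (fun i s => Nat.add s (f i)) n

theorem sumTo_eq (f : ℕ → ℕ) (n : ℕ) : sumTo f n = ∑ i ∈ Finset.range n, f i := by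
  induction n with
  | zero => rfl
  | succ n ih =>
    rw [Finset.sum_range_succ, ← ih]
    rfl

/-- The number with the first `n` values of `f` as digits in base `2 ^ 64`. -/
def packDigits (f : ℕ → ℕ) (n : ℕ) : ℕ :=
  Nat.rec 0 (fun i s => Nat.add s (Nat.shiftLeft (f i) (Nat.mul 64 i))) n

/-- Whether the first `n` values of `f` are all true. -/
def allLt (f : ℕ → Bool) (n : ℕ) : Bool :=
  Nat.rec true (fun i b => and b (f i)) n

theorem allLt_eq_true {f : ℕ → Bool} {n : ℕ} (h : allLt f n = true) : ∀ i < n, f i = true := by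
  induction n with
  | zero => exact fun i hi => absurd hi (Nat.not_lt_zero i)
  | succ n ih =>
    have h' : (allLt f n && f n) = true := h
    rw [Bool.and_eq_true] at h'
    intro i hi
    rcases Nat.lt_succ_iff_lt_or_eq.1 hi with hi | rfl
    exacts [ih h'.1 i hi, h'.2]

/-- Application of `f` to `n`, with `n` evaluated first by the kernel. -/
def applyValue (f : ℕ → Bool) (n : ℕ) : Bool :=
  Nat.rec (f 0) (fun m _ => f (Nat.succ m)) n

theorem applyValue_eq (f : ℕ → Bool) (n : ℕ) : applyValue f n = f n := by
  cases n <;> rfl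

/-- Tables that describe a colouring of the subspaces of `Code 8` with three colours which is
invariant under a cyclic group of linear maps.  The generator is `act`, and `weight` is a function
that it multiplies by `mult`. -/
structure OrbitColouring where
  actTable : ℕ
  keyTable : ℕ
  stepTable : ℕ
  weightTable : ℕ
  mult : ℕ
  order : ℕ
  modulus : ℕ
  size₁ : ℕ
  size₂ : ℕ
  size₃ : ℕ
  table₁ : ℕ
  table₂ : ℕ
  table₃ : ℕ

namespace OrbitColouring
variable (D : OrbitColouring)

/-- The generator of the group. -/
def act (x : ℕ) : ℕ :=
  lookup 8 D.actTable x

/-- The representative of the orbit of a vector. -/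
def key (x : ℕ) : ℕ :=
  lookup 8 D.keyTable x

/-- The number of applications of the generator that lead from a vector to its representative. -/
def steps (x : ℕ) : ℕ :=
  lookup 8 D.stepTable x

/-- The weight of a vector. -/
def weight (x : ℕ) : ℕ :=
  lookup 48 D.weightTable x

/-- The colour of a subspace whose weights have the sum `s`. -/
def colour (s : ℕ) : ℕ :=
  -- The group scales `s` by powers of `mult`, so `h = s ^ order` modulo `modulus` is an orbit
  -- invariant. The colour adds three table entries modulo 3, found at three residues of `h`.
  (fun h => Nat.mod (Nat.add (lookup 2 D.table₁ (Nat.mod h D.size₁))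
    (Nat.add (lookup 2 D.table₂ (Nat.mod h D.size₂)) (lookup 2 D.table₃ (Nat.mod h D.size₃)))) 3)
    (Nat.mod (Nat.pow s D.order) D.modulus)

/-- The sum of the weights of a coset of the span of `x` and `y`. -/
def cosetWeight (x y u : ℕ) : ℕ :=
  Nat.add (Nat.add (D.weight u) (D.weight (Nat.xor x u)))
    (Nat.add (D.weight (Nat.xor y u)) (D.weight (Nat.xor (Nat.xor x y) u)))

/-- The colours of the subspaces of dimension one, from the table `t` of coset weights. -/
def singleTotal (t : ℕ) : ℕ :=
  sumTo (fun i => Nat.pow 8192 (D.colour (Nat.add (lookup 64 t 0) (lookup 64 t (Nat.succ i))))) 63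

/-- The colours of the subspaces of dimension two, from the table `t` of coset weights. -/
def pairTotal (t : ℕ) : ℕ :=
  sumTo (fun i => sumTo (fun j => cond (Nat.ble (Nat.succ i) j)
    (cond (Nat.ble (Nat.succ j) (Nat.xor i j))
      (Nat.pow 8192 (D.colour (Nat.add (Nat.add (lookup 64 t 0) (lookup 64 t i))
        (Nat.add (lookup 64 t j) (lookup 64 t (Nat.xor i j)))))) 0) 0) 64) 64

/-- Whether the colours of the superspaces of the span of `x` and `y` are balanced. -/
def check (total : ℕ → ℕ) (m x y : ℕ) : Bool :=
  -- The 64 coset weights are packed into one number and reused for all superspaces. Reading the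
  -- digits back and comparing them replaces a proof that packing is lossless. `67117057 = 1 + 8192
  -- + 8192 ^ 2` encodes equal counts.
  (fun w => applyValue (fun t => and (allLt (fun i => Nat.beq (lookup 64 t i) (w i)) 64)
    (Nat.beq (total t) (Nat.mul m 67117057))) (packDigits w 64))
    (fun i => D.cosetWeight x y (insertZeros (Nat.log2 x) (Nat.log2 y) i))

/-- Whether `check` holds for every plane in normal form that contains `x`. -/
def rowCheck (total : ℕ → ℕ) (m x : ℕ) : Bool :=
  allLt (fun y => or (or (Nat.beq y 0) (Nat.testBit y (Nat.log2 x)))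
    (or (or (Nat.ble (Nat.succ (D.key y)) x) (Nat.ble (Nat.succ (D.key (Nat.xor x y))) x))
      (D.check total m x y))) 256

/-- The compatibility of the tables. -/
structure Valid : Prop where
  act_lt : ∀ x < 256, D.act x < 256
  act_xor_two_pow : ∀ x < 256, ∀ b < 8, D.act (x ^^^ 2 ^ b) = D.act x ^^^ D.act (2 ^ b)
  act_ne_zero : ∀ x < 256, x ≠ 0 → D.act x ≠ 0
  weight_act : ∀ x < 256, D.weight (D.act x) % D.modulus = D.mult * D.weight x % D.modulus
  mult_pow : D.mult ^ D.order % D.modulus = 1 % D.modulus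
  key_act : ∀ x < 256, D.key (D.act x) = D.key x
  iterate_steps : ∀ x < 256, x ≠ 0 → D.act^[D.steps x] x = D.key x

theorem colour_lt (s : ℕ) : D.colour s < 3 :=
  Nat.mod_lt _ (by norm_num)

theorem colour_congr {s s' : ℕ} (h : s ^ D.order % D.modulus = s' ^ D.order % D.modulus) :
    D.colour s = D.colour s' :=
  congrArg (fun h => (lookup 2 D.table₁ (h % D.size₁) + (lookup 2 D.table₂ (h % D.size₂) +
    lookup 2 D.table₃ (h % D.size₃))) % 3) h

/-- The sum of the weights of the elements of a subspace. -/
noncomputable def weightSum (B : Submodule (ZMod 2) (Code 8)) : ℕ :=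
  ∑ z ∈ finsetOf (fun z => z ∈ B), D.weight z.1

/-- The colouring as a function with values in the cube roots of unity. -/
noncomputable def root (B : Submodule (ZMod 2) (Code 8)) : ℂ :=
  cubeRoot ^ D.colour (D.weightSum B)

theorem root_pow_three (B : Submodule (ZMod 2) (Code 8)) : D.root B ^ 3 = 1 := by
  rw [root, ← pow_mul, mul_comm, pow_mul, cubeRoot_pow_three, one_pow]

variable {D}

/-- Additivity is tabulated only for powers of two; induction on the binary length of `y` gives the
rest. -/
theorem Valid.act_xor (h : D.Valid) {x y : ℕ} (hx : x < 2 ^ 8) (hy : y < 2 ^ 8) :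
    D.act (x ^^^ y) = D.act x ^^^ D.act y := by
  have h0 : D.act 0 = 0 := by
    have := h.act_xor_two_pow 1 (by norm_num) 0 (by norm_num)
    simpa using this
  have key : ∀ k ≤ 8, ∀ x < 2 ^ 8, ∀ y < 2 ^ k, D.act (x ^^^ y) = D.act x ^^^ D.act y := by
    intro k
    induction k with
    | zero =>
      intro _ x _ y hy
      rw [Nat.lt_one_iff.1 hy, Nat.xor_zero, h0, Nat.xor_zero]
    | succ k ih =>
      intro hk x hx y hy
      have hlt : ∀ z < 2 ^ (k + 1), z.testBit k = false → z < 2 ^ k := by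
        intro z hz hzk
        refine Nat.lt_pow_two_of_testBit _ fun i hi => ?_
        rcases Nat.eq_or_lt_of_le hi with rfl | hi
        · exact hzk
        · exact Nat.testBit_lt_two_pow (hz.trans_le (Nat.pow_le_pow_right (by norm_num) hi))
      have hpow : 2 ^ k < 2 ^ 8 := Nat.pow_lt_pow_right (by norm_num) hk
      cases hyk : y.testBit k
      · exact ih (by omega) x hx y (hlt y hy hyk)
      · have hy' : y ^^^ 2 ^ k < 2 ^ k := by
          refine hlt _ (Nat.xor_lt_two_pow hy (Nat.pow_lt_pow_right (by norm_num) k.lt_succ_self)) ?_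
          rw [Nat.testBit_xor, hyk, Nat.testBit_two_pow_self]
          rfl
        have hyy : y = 2 ^ k ^^^ (y ^^^ 2 ^ k) := by
          rw [Nat.xor_comm y, ← Nat.xor_assoc, Nat.xor_self, Nat.zero_xor]
        rw [hyy, ← Nat.xor_assoc, ih (by omega) _ (Nat.xor_lt_two_pow hx hpow) _ hy',
          ih (by omega) _ hpow _ hy', h.act_xor_two_pow x hx k hk, Nat.xor_assoc]
  exact key 8 le_rfl x hx y hy

/-- The generator as a linear equivalence. -/
noncomputable def Valid.equiv (h : D.Valid) : Code 8 ≃ₗ[ZMod 2] Code 8 :=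
  LinearEquiv.ofInjectiveEndo (AddMonoidHom.toZModLinearMap 2
    (AddMonoidHom.mk' (fun x : Code 8 => (⟨D.act x.1, h.act_lt x.1 x.2⟩ : Code 8))
      fun x y => Code.ext (h.act_xor x.2 y.2))) (by
    rw [injective_iff_map_eq_zero]
    intro x hx
    by_contra h0
    exact h.act_ne_zero x.1 x.2 (fun h1 => h0 (Code.ext h1)) (congrArg Subtype.val hx))

theorem Valid.val_equiv (h : D.Valid) (x : Code 8) : (h.equiv x).1 = D.act x.1 :=
  rfl

/-- The generator multiplies the weight sum by `mult` modulo `modulus`, and `mult ^ order` is 1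
there. -/
theorem Valid.root_map (h : D.Valid) (B : Submodule (ZMod 2) (Code 8)) :
    D.root (B.map h.equiv.toLinearMap) = D.root B := by
  have h1 : D.weightSum (B.map h.equiv.toLinearMap) =
      ∑ z ∈ finsetOf (fun z => z ∈ B), D.weight (D.act z.1) := by
    symm
    refine Finset.sum_nbij h.equiv ?_ h.equiv.injective.injOn ?_ fun _ _ => rfl
    · intro z hz
      rw [mem_finsetOf] at hz ⊢
      exact Submodule.mem_map_of_mem hz
    · intro z hz
      rw [Finset.mem_coe, mem_finsetOf] at hz
      obtain ⟨w, hw, rfl⟩ := hz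
      exact ⟨w, by rwa [Finset.mem_coe, mem_finsetOf], rfl⟩
  have h2 : D.weightSum (B.map h.equiv.toLinearMap) ≡ D.mult * D.weightSum B [MOD D.modulus] := by
    rw [h1, weightSum, Finset.mul_sum]
    unfold Nat.ModEq
    rw [Finset.sum_nat_mod]
    conv_rhs => rw [Finset.sum_nat_mod]
    refine congrArg (· % D.modulus) (Finset.sum_congr rfl fun z _ => ?_)
    exact h.weight_act z.1 z.2
  unfold root
  rw [D.colour_congr]
  calc D.weightSum (B.map h.equiv.toLinearMap) ^ D.order
      ≡ (D.mult * D.weightSum B) ^ D.order [MOD D.modulus] := h2.pow _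
    _ = D.mult ^ D.order * D.weightSum B ^ D.order := mul_pow _ _ _
    _ ≡ 1 * D.weightSum B ^ D.order [MOD D.modulus] := Nat.ModEq.mul_right _ h.mult_pow
    _ = D.weightSum B ^ D.order := one_mul _

theorem Valid.sumBetween_map (h : D.Valid) (k : ℕ) (T : Submodule (ZMod 2) (Code 8)) :
    sumBetween D.root k (T.map h.equiv.toLinearMap) ⊤ = sumBetween D.root k T ⊤ := by
  symm
  unfold sumBetween
  refine Finset.sum_nbij (fun B => B.map h.equiv.toLinearMap) ?_
    (Submodule.map_injective_of_injective h.equiv.injective).injOn ?_ fun B _ => (h.root_map B).symm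
  · intro B hB
    simp only [mem_finsetOf, le_top, true_and] at hB ⊢
    exact ⟨Submodule.map_mono hB.1, (LinearEquiv.finrank_map_eq h.equiv B).trans hB.2⟩
  · intro B hB
    simp only [Finset.mem_coe, mem_finsetOf, le_top, true_and] at hB
    have hmap := Submodule.map_comap_eq_of_surjective h.equiv.surjective B
    refine ⟨B.comap h.equiv.toLinearMap, ?_, hmap⟩
    simp only [Finset.mem_coe, mem_finsetOf, le_top, true_and]
    refine ⟨Submodule.map_le_iff_le_comap.1 hB.1, ?_⟩
    rw [← hB.2]
    have := LinearEquiv.finrank_map_eq h.equiv (B.comap h.equiv.toLinearMap)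
    exact this.symm.trans (congrArg (fun A : Submodule (ZMod 2) (Code 8) => finrank (ZMod 2) A) hmap)

theorem Valid.key_iterate (h : D.Valid) (n : ℕ) (x : Code 8) :
    D.key (h.equiv^[n] x).1 = D.key x.1 := by
  induction n with
  | zero => rfl
  | succ n ih => rw [Function.iterate_succ_apply', val_equiv, h.key_act _ (h.equiv^[n] x).2, ih]

theorem Valid.val_iterate (h : D.Valid) (n : ℕ) (x : Code 8) :
    (h.equiv^[n] x).1 = D.act^[n] x.1 := by
  induction n with
  | zero => rfl
  | succ n ih => rw [Function.iterate_succ_apply', Function.iterate_succ_apply', val_equiv, ih]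

/-- Normal form of a plane: take a nonzero vector with least orbit representative, move it by the
group to that representative `x`, and complete to a basis by `y`, adding `x` if needed to clear the
leading digit of `x`. -/
theorem Valid.sumBetween_eq_zero (h : D.Valid) {k : ℕ}
    (hT : ∀ x y : Code 8, x ≠ 0 → D.key x.1 = x.1 → y ≠ 0 → y.1.testBit (Nat.log2 x.1) = false →
      x.1 ≤ D.key y.1 → x.1 ≤ D.key (x.1 ^^^ y.1) → sumBetween D.root k (span (ZMod 2) {x, y}) ⊤ = 0)
    {T : Submodule (ZMod 2) (Code 8)} (hdim : finrank (ZMod 2) T = 2) :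
    sumBetween D.root k T ⊤ = 0 := by
  have hiter : ∀ n : ℕ, ∃ T' : Submodule (ZMod 2) (Code 8), finrank (ZMod 2) T' = 2 ∧
      sumBetween D.root k T' ⊤ = sumBetween D.root k T ⊤ ∧
      (∀ z ∈ T, h.equiv^[n] z ∈ T') ∧ ∀ z ∈ T', ∃ w ∈ T, h.equiv^[n] w = z := by
    intro n
    induction n with
    | zero => exact ⟨T, hdim, rfl, fun z hz => hz, fun z hz => ⟨z, hz, rfl⟩⟩
    | succ n ih =>
      obtain ⟨T', h1, h2, h3, h4⟩ := ih
      refine ⟨T'.map h.equiv.toLinearMap, (LinearEquiv.finrank_map_eq h.equiv T').trans h1,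
        (h.sumBetween_map k T').trans h2, ?_, ?_⟩
      · intro z hz
        rw [Function.iterate_succ_apply']
        exact Submodule.mem_map_of_mem (h3 z hz)
      · rintro _ ⟨z, hz, rfl⟩
        obtain ⟨w, hw, rfl⟩ := h4 z hz
        exact ⟨w, hw, Function.iterate_succ_apply' _ _ _⟩
  have hne : (finsetOf fun z : Code 8 => z ∈ T ∧ z ≠ 0).Nonempty := by
    obtain ⟨z, hz, hz0⟩ := Submodule.exists_mem_ne_zero_of_ne_bot (p := T) (by
      rintro rfl
      rw [finrank_bot] at hdim
      omega)
    exact ⟨z, mem_finsetOf.2 ⟨hz, hz0⟩⟩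
  obtain ⟨z, hz, hmin⟩ := Finset.exists_min_image _ (fun z : Code 8 => D.key z.1) hne
  rw [mem_finsetOf] at hz
  obtain ⟨T', h1, h2, h3, h4⟩ := hiter (D.steps z.1)
  set x := h.equiv^[D.steps z.1] z with hx
  have hxT : x ∈ T' := h3 z hz.1
  have hxval : x.1 = D.key z.1 := by
    rw [hx, h.val_iterate, h.iterate_steps z.1 z.2 fun h0 => hz.2 (Code.ext h0)]
  have hxkey : D.key x.1 = x.1 := by
    rw [hx, h.key_iterate, ← hx, hxval]
  have hinj : Function.Injective h.equiv^[D.steps z.1] := h.equiv.injective.iterate _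
  have hzero : h.equiv^[D.steps z.1] 0 = 0 := Function.iterate_fixed (map_zero h.equiv) _
  have hx0 : x ≠ 0 := fun h0 => hz.2 (hinj (h0.trans hzero.symm))
  have hlow : ∀ w ∈ T', w ≠ 0 → x.1 ≤ D.key w.1 := by
    intro w hw hw0
    obtain ⟨w', hw', rfl⟩ := h4 w hw
    rw [h.key_iterate, hxval]
    refine hmin w' (mem_finsetOf.2 ⟨hw', ?_⟩)
    rintro rfl
    exact hw0 hzero
  obtain ⟨y, hy, hyx⟩ : ∃ y ∈ T', y ∉ span (ZMod 2) {x} := by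
    by_contra! h5
    have := Submodule.finrank_mono (show T' ≤ span (ZMod 2) {x} from h5)
    rw [finrank_span_singleton hx0] at this
    omega
  have hxbit : x.1.testBit (Nat.log2 x.1) = true :=
    Nat.testBit_log2 fun h0 => hx0 (Code.ext h0)
  obtain ⟨y, hy, hyx, hbit⟩ : ∃ y ∈ T', y ∉ span (ZMod 2) {x} ∧
      y.1.testBit (Nat.log2 x.1) = false := by
    cases hb : y.1.testBit (Nat.log2 x.1)
    · exact ⟨y, hy, hyx, hb⟩
    · refine ⟨x + y, T'.add_mem hxT hy, fun h6 => hyx ?_, ?_⟩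
      · exact (Submodule.add_mem_iff_right _ (mem_span_singleton_self x)).1 h6
      · rw [Code.val_add, Nat.testBit_xor, hxbit, hb]
        rfl
  have hy0 : y ≠ 0 := fun h0 => hyx (h0 ▸ zero_mem _)
  have hxy : x ≠ y := fun h0 => hyx (h0 ▸ mem_span_singleton_self x)
  have hxy0 : x + y ≠ 0 := fun h0 => hyx (by
    have h5 : (x + y) + x ∈ span (ZMod 2) {x} := by
      rw [h0, zero_add]
      exact mem_span_singleton_self x
    rwa [add_comm x, add_assoc, add_self_of_zmod_two, add_zero] at h5)
  have hspan : span (ZMod 2) {x, y} = T' := by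
    refine Submodule.eq_of_le_of_finrank_eq ?_ ((finrank_span_pair hx0 hy0 hxy).trans h1.symm)
    rw [span_le]
    rintro w (rfl | rfl)
    exacts [hxT, hy]
  rw [← h2, ← hspan]
  exact hT x y hx0 hxkey hy0 hbit (hlow y hy hy0) (hlow _ (T'.add_mem hxT hy) hxy0)

/-- The total `total` detects balanced colourings of the `d`-dimensional subspaces. -/
def Detects (D : OrbitColouring) (total : ℕ → ℕ) (m d : ℕ) : Prop :=
  ∀ (t : ℕ) (g : Code 6 → ℕ), (∀ u, lookup 64 t u.1 = g u) → total t = m * 67117057 →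
    ∑ A ∈ finsetOf (fun A : Submodule (ZMod 2) (Code 6) => finrank (ZMod 2) A = d),
      cubeRoot ^ D.colour (∑ u ∈ finsetOf (fun u => u ∈ A), g u) = 0

theorem card_code (n : ℕ) (p : Code n → Prop) : (finsetOf p).card ≤ 2 ^ n := by
  rw [card_finsetOf]
  have h : Nat.card (Code n) = 2 ^ n := by
    have := Module.natCard_eq_pow_finrank (K := ZMod 2) (V := Code n)
    rwa [Nat.card_eq_fintype_card (α := ZMod 2), ZMod.card, Code.finrank_eq] at this
  rw [← h]
  exact Nat.card_le_card_of_injective _ Subtype.val_injective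

theorem card_code_prod (n : ℕ) (p : Code n × Code n → Prop) :
    (finsetOf p).card ≤ 2 ^ n * 2 ^ n := by
  have h1 : finsetOf p ⊆ (finsetOf fun _ : Code n => True) ×ˢ (finsetOf fun _ : Code n => True) := by
    intro v _
    rw [Finset.mem_product]
    exact ⟨mem_finsetOf.2 trivial, mem_finsetOf.2 trivial⟩
  refine (Finset.card_le_card h1).trans ?_
  rw [Finset.card_product]
  exact Nat.mul_le_mul (card_code n _) (card_code n _)

theorem detects_singleTotal (D : OrbitColouring) (m : ℕ) : D.Detects D.singleTotal m 1 := by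
  intro t g hg ht
  rw [sum_finrank_one (V := Code 6)
    (fun A => cubeRoot ^ D.colour (∑ u ∈ finsetOf (fun u => u ∈ A), g u))]
  refine sum_cubeRoot_pow_eq_zero (m := m) (fun _ _ => D.colour_lt _)
    ((card_code 6 _).trans_lt (by norm_num)) ?_
  rw [show m * (1 + 8192 + 8192 ^ 2) = m * 67117057 by norm_num, ← ht, singleTotal, sumTo_eq]
  -- The nonzero vectors `1, ..., 63` are indexed by `i < 63` through `u = i + 1`.
  refine Finset.sum_bij' (fun u _ => u.1 - 1) (fun i hi => (⟨i + 1, ?_⟩ : Code 6)) ?_ ?_ ?_ ?_ ?_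
  · rw [Finset.mem_range] at hi
    norm_num
    omega
  · intro u hu
    have := u.2
    rw [Finset.mem_range]
    omega
  · intro i hi
    refine mem_finsetOf.2 fun h0 => ?_
    have := congrArg Subtype.val h0
    simp at this
  · intro u hu
    rw [mem_finsetOf] at hu
    have : u.1 ≠ 0 := fun h0 => hu (Code.ext h0)
    exact Code.ext (Nat.succ_pred_eq_of_pos (Nat.pos_of_ne_zero this))
  · intro i hi
    rfl
  · intro u hu
    rw [mem_finsetOf] at hu
    have : u.1 ≠ 0 := fun h0 => hu (Code.ext h0)
    rw [sum_mem_span_singleton hu, ← hg, ← hg, Nat.succ_eq_add_one,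
      Nat.sub_add_cancel (Nat.pos_of_ne_zero this)]
    rfl

theorem sum_range_pair_eq (n : ℕ) (F : ℕ → ℕ → ℕ) :
    ∑ i ∈ Finset.range (2 ^ n), ∑ j ∈ Finset.range (2 ^ n),
      (if i < j ∧ j < i ^^^ j then F i j else 0) =
      ∑ v ∈ finsetOf (fun v : Code n × Code n => v.1.1 < v.2.1 ∧ v.2.1 < v.1.1 ^^^ v.2.1),
        F v.1.1 v.2.1 := by
  rw [← Finset.sum_product' (f := fun i j => if i < j ∧ j < i ^^^ j then F i j else 0),
    ← Finset.sum_filter]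
  symm
  refine Finset.sum_bij' (fun v _ => (v.1.1, v.2.1))
    (fun e he => ((⟨e.1, ?_⟩ : Code n), (⟨e.2, ?_⟩ : Code n))) ?_ ?_ ?_ ?_ ?_
  · simp only [Finset.mem_filter, Finset.mem_product, Finset.mem_range] at he
    exact he.1.1
  · simp only [Finset.mem_filter, Finset.mem_product, Finset.mem_range] at he
    exact he.1.2
  · intro v hv
    rw [mem_finsetOf] at hv
    simp only [Finset.mem_filter, Finset.mem_product, Finset.mem_range]
    exact ⟨⟨v.1.2, v.2.2⟩, hv⟩
  · intro e he
    rw [Finset.mem_filter] at he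
    exact mem_finsetOf.2 he.2
  · intro v hv
    rfl
  · intro e he
    rfl
  · intro v hv
    rfl

theorem detects_pairTotal (D : OrbitColouring) (m : ℕ) : D.Detects D.pairTotal m 2 := by
  intro t g hg ht
  rw [Code.sum_finrank_two
    (fun A => cubeRoot ^ D.colour (∑ u ∈ finsetOf (fun u => u ∈ A), g u))]
  refine sum_cubeRoot_pow_eq_zero (m := m) (fun _ _ => D.colour_lt _)
    ((card_code_prod 6 _).trans_lt (by norm_num)) ?_
  rw [show m * (1 + 8192 + 8192 ^ 2) = m * 67117057 by norm_num, ← ht, pairTotal, sumTo_eq]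
  simp_rw [sumTo_eq]
  have hfilter : ∀ i j : ℕ, (cond (Nat.ble (Nat.succ i) j)
      (cond (Nat.ble (Nat.succ j) (Nat.xor i j))
      (Nat.pow 8192 (D.colour (Nat.add (Nat.add (lookup 64 t 0) (lookup 64 t i))
        (Nat.add (lookup 64 t j) (lookup 64 t (Nat.xor i j)))))) 0) 0) =
      if i < j ∧ j < i ^^^ j then 8192 ^ D.colour (lookup 64 t 0 + lookup 64 t i +
        (lookup 64 t j + lookup 64 t (i ^^^ j))) else 0 := by
    intro i j
    have hx : Nat.xor i j = i ^^^ j := rfl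
    rw [hx]
    split_ifs with h
    · rw [Nat.ble_eq_true_of_le h.1, Nat.ble_eq_true_of_le h.2]
      rfl
    · rw [not_and_or] at h
      rcases h with h | h
      · have : Nat.ble (Nat.succ i) j = false := by
          rw [← Bool.not_eq_true, Nat.ble_eq]
          exact h
        rw [this]
        rfl
      · have : Nat.ble (Nat.succ j) (i ^^^ j) = false := by
          rw [← Bool.not_eq_true, Nat.ble_eq]
          exact h
        rw [this]
        cases Nat.ble (Nat.succ i) j <;> rfl
  simp_rw [hfilter]
  refine Eq.trans ?_ (sum_range_pair_eq 6 fun i j => 8192 ^ D.colour (lookup 64 t 0 +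
    lookup 64 t i + (lookup 64 t j + lookup 64 t (i ^^^ j)))).symm
  refine Finset.sum_congr rfl fun v hv => ?_
  rw [mem_finsetOf] at hv
  have h1 : v.1 ≠ 0 := by
    intro h0
    have h2 := hv.2
    rw [h0, Code.val_zero, Nat.zero_xor] at h2
    exact h2.false
  have h2 : v.2 ≠ 0 := by
    intro h0
    have h2 := hv.1
    rw [h0, Code.val_zero] at h2
    exact Nat.not_lt_zero _ h2
  have h3 : v.1 ≠ v.2 := fun h0 => (h0 ▸ hv.1).false
  rw [sum_mem_span_pair h1 h2 h3, ← hg, ← hg, ← hg, ← hg]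
  rfl

/-- A superspace of the plane is a union of its cosets, indexed by a subspace of `Code 6`, so its
weight sum is a sum of the tabulated coset weights. -/
theorem Valid.sumBetween_eq_zero_of_check (_h : D.Valid) {total : ℕ → ℕ} {m d : ℕ}
    (hD : D.Detects total m d) {x y : Code 8} (hx : x ≠ 0) (hy : y ≠ 0)
    (hbit : y.1.testBit (Nat.log2 x.1) = false) (hc : D.check total m x.1 y.1 = true) :
    sumBetween D.root (d + 2) (span (ZMod 2) {x, y}) ⊤ = 0 := by
  have hx' : x.1 ≠ 0 := fun h0 => hx (Code.ext h0)
  have hy' : y.1 ≠ 0 := fun h0 => hy (Code.ext h0)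
  have hlog : ∀ z : Code 8, z.1 ≠ 0 → Nat.log2 z.1 < 6 + 2 := fun z hz => (Nat.log2_lt hz).2 z.2
  let p : Fin (6 + 2) := ⟨Nat.log2 x.1, hlog x hx'⟩
  let q : Fin (6 + 2) := ⟨Nat.log2 y.1, hlog y hy'⟩
  have hxp : x.1.testBit p = true := Nat.testBit_log2 hx'
  have hyq : y.1.testBit q = true := Nat.testBit_log2 hy'
  have hpq : p ≠ q := by
    intro h0
    rw [← h0] at hyq
    rw [show y.1.testBit p = false from hbit] at hyq
    exact absurd hyq (by simp)
  have hxy : x ≠ y := by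
    rintro rfl
    rw [show x.1.testBit p = false from hbit] at hxp
    exact absurd hxp (by simp)
  let s := Code.insertLinear p q hpq
  have hs : Function.Injective s := Code.insertLinear_injective p q hpq
  have hcompl : IsCompl (span (ZMod 2) {x, y}) (LinearMap.range s) :=
    Code.isCompl_span_pair_range hpq hxp hbit hyq
  have h1 := sumBetween_eq_sum_of_isCompl D.root hs hcompl d
  rw [finrank_span_pair hx hy hxy] at h1
  rw [h1]
  simp only [check, applyValue_eq, Bool.and_eq_true, Nat.beq_eq] at hc
  obtain ⟨hc1, hc2⟩ := hc
  have hc3 := allLt_eq_true hc1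
  rw [← hD _ (fun u => ∑ z ∈ finsetOf (fun z => z ∈ span (ZMod 2) {x, y}), D.weight (z + s u).1)
    ?_ hc2]
  · refine Finset.sum_congr rfl fun A _ => ?_
    rw [root, weightSum, sum_mem_sup_map hs hcompl.disjoint A (fun z => D.weight z.1)]
  · intro u
    have h2 := hc3 u.1 u.2
    rw [Nat.beq_eq] at h2
    rw [h2, sum_mem_span_pair hx hy hxy (fun z => D.weight (z + s u).1)]
    simp only [zero_add]
    rfl

theorem Valid.hasNull (h : D.Valid) {total : ℕ → ℕ} {m d : ℕ} (hD : D.Detects total m d)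
    (hrow : ∀ x < 256, x ≠ 0 → D.key x = x → D.rowCheck total m x = true) :
    HasNull (Fin 8 → ZMod 2) (d + 2) 3 := by
  have h1 : HasNull (Code 8) (d + 2) 3 := by
    refine ⟨D.root, D.root_pow_three, isNull_succ_of_finrank_eq (by omega) fun T hT =>
      h.sumBetween_eq_zero (fun x y hx hkey hy hbit hxy1 hxy2 => ?_) hT⟩
    refine h.sumBetween_eq_zero_of_check hD hx hy hbit ?_
    have h2 := allLt_eq_true (hrow x.1 x.2 (fun h0 => hx (Code.ext h0)) hkey) y.1 y.2
    simp only [Bool.or_eq_true, Nat.beq_eq, Nat.ble_eq] at h2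
    rcases h2 with (h2 | h2) | (h2 | h2) | h2
    · exact absurd (Code.ext h2) hy
    · rw [hbit] at h2
      exact absurd h2 (by simp)
    · exact absurd h2 (Nat.not_le.2 (Nat.lt_succ_of_le hxy1))
    · exact absurd h2 (Nat.not_le.2 (Nat.lt_succ_of_le hxy2))
    · exact h2
  exact h1.of_finrank_eq (by rw [Code.finrank_eq, finrank_fin_fun])

end OrbitColouring

/-! ### The two computed colourings in dimension 8 -/

/-- A balanced colouring of the three-dimensional subspaces. -/
def colouring₃ : OrbitColouring where
  -- Multiplication by `x` in `GF(2)[x]/(x⁸ + x⁴ + x³ + x² + 1)`, a Singer cycle: all 255 nonzero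
  -- vectors form one orbit, with representative 1.
  actTable := 0xe3e1e7e5ebe9efedf3f1f7f5fbf9fffdc3c1c7c5cbc9cfcdd3d1d7d5dbd9dfdda3a1a7a5aba9afadb3b1b7b5bbb9bfbd838187858b898f8d939197959b999f9d636167656b696f6d737177757b797f7d434147454b494f4d535157555b595f5d232127252b292f2d333137353b393f3d030107050b090f0d131117151b191f1dfefcfaf8f6f4f2f0eeeceae8e6e4e2e0dedcdad8d6d4d2d0cecccac8c6c4c2c0bebcbab8b6b4b2b0aeacaaa8a6a4a2a09e9c9a98969492908e8c8a88868482807e7c7a78767472706e6c6a68666462605e5c5a58565452504e4c4a48464442403e3c3a38363432302e2c2a28262422201e1c1a18161412100e0c0a0806040200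
  keyTable := 0x1010101010101010101010101010101010101010101010101010101010101010101010101010101010101010101010101010101010101010101010101010101010101010101010101010101010101010101010101010101010101010101010101010101010101010101010101010101010101010101010101010101010101010101010101010101010101010101010101010101010101010101010101010101010101010101010101010101010101010101010101010101010101010101010101010101010101010101010101010101010101010101010101010101010101010101010101010101010101010101010101010101010101010101010101010100
  stepTable := 0x50a7af57150b298b17521819162a51b028d38a8514e90af4ae5f56634fa0a634a5c133444e799f0455aa62d6adc45e930990f38013b6e83b895b844827bcd2e05dbe92b8acc6c37b61a2d5eb542ca90d9e4103234d68786f3230436aa42ec0c8d176dfdc266dbbee834b47d988665a1ce7013ace1221b598f29c7f73083f8ff8a8580c8c531a2bb1d486eaf56064a135c2457a05abd7c5949181b73c5c49bde1bfb9c77ca3ec2d0e42246970316b2fc977dd6eef4cda671d02cf22999d7440f9598d1bb287f665364606d895823d4ae2ba7ded0f25716ccadef0db1ed09a75fa8eb3f73707963ee37e1072cbf11f9bfbb43897e411cc20fc39e5cdfde6fe0000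
  weightTable := 0x11162c730c3b1fcdb8473b4f752ca437c9db7b40e0aeb3da537d07a4570868078386a02b41258a57e66675c6ee26f3eb5a1ccfa6648d1ed0df43241f02111132b10c4a027b4ff38969b3cacd8bfa4a4b9b2a8c4c46a4b76bc8582d7b952d636e185739fdf9db19d6a892118858ac7b23559d02c47ce2f4865bc4c8bf898009b7dec1d4871cb62a1801b23193ea4ac6f04220d6cc5c0c43ef5f1309e430ae92c07403128229ef6b535ecd244b73564526d720093d41b2e83e06516b97e49fc75028559dd0b3b4635c7d5fcf0d38382eda3b0650c6d9423cf27cdc620cd91a62a999845075553e75c1fa3452a1802ad6464497cfb4ea9254b75759a9900222086dd860395511d02b8b21fe0ced55d4732a7b672ea715cf92295fc8229ea3598489144def528b023adf6314bd39660e17ec4aa167133e894e39106ddb88c7bc648c4b7a8ca010767e2b08873d3408472a0800f7c17f1b9f111cfaf1512136a8818cc14d20b53194c33e4450556bc7344d60b87f5064328b069eca0d320f71ed72e904591eb7d1621d5f8f208ed4559625cfca3c3b15ac4f42cd032a970a7ee67e1d0ca77ece0a535fefb6ff6e2146d057223a3c8ab054b86abb18d3bb604998aa806c1e05c68112fb2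d4c7379fa3bc64030377c88ec5a2c616da23b2981bcc9965d7a3472217462217c78dadb6c45190adb93547b40832b5b3a6b580c0df2193f78442de2ac3b3d60d707532a9dfdd1e4ff6da1eee81eec7d3e09c69bca0df2c4b08eaa1630ccedc9bf7e27f3ac923b55d99d83ab494620954dcfc51b3c150eea6d1bed3dff62405aeffca943e82763dc1623775d05817b9dc35c5d334cb567684fbcc5b3d3490ea04b501a53fae876d6b96136c882f3a6143d30bea692583ddf0cc7c11e804bebb6406fdcf675fe46671bbe5132324955485e572f62bd0d4b64b14744e570ad9e5e1cd3d0c72021007aa7177d4ccd0ae59f050d2b120301a2653fa09577785a20db1e4dab1fb4eaa640fd327fb831a37f19bacda8c1b80f31f0341bb1100b39d7cd644eb1f05a981376b85a88411575549f7ec75f157ed014655102f2ba8d1ccd18e8e8371659613729d51daa6f93400afa3363d5fbaa75e2623786c6eb5c4f5416f644ab5b030b1e7fab268274a15784033e9cba1782599ddb259c6a269bf8214fb23dd7a15b112c78d91434bb3c21ed6dfc906a7fefa8c685ee159f32079aa232f299d6159c77efd958e485417e1369ddf87134996ec3df2dbfc4443e2910cb738c3ca57f8fc6b5e9667dc5005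ad9e0067ab6b34b0a545c3ac890c40cc04f8767830d4aac0066e91fbd75f23fff3019e04955195b8ba92a310f16522b6ddeba06fd3068940129c5db59d58a1fc26c94d60d6da4cddec09774c92f481f007e61c69bf08f326829c15161240658d7bb4a50895b960f8806dba81fe72d592b017989871c86e0245425502b9fe4a3432ad7328787f456215dc22e6b32c15350d59557eadaafc5b62baa24c054f905b87015c3c271ea0eea417c7ffd79566eb22574357dad7b1f6ee0cd9dfa01948846ccc14226df702a9b2e81b112eed85b3e3e46eb572ccb163998c40c502bc62834663fd534deb0230ae807f9716b3da908ccb0462bb4fbc5ba16098afa39552cf4f0ed960c35588f9c42536c2883192d1c59789f1839f758299feb982e625a17d2447441676fe14af248ef99f9601340224fa583e853de751fd04a6324f4bf8728792d9ff33dde619fae7392a2469c052ad918351dbf633b99525850a92fda0029bb62b04445e94736efe21f25e60d1b834286b2f9cb686a3849fe5d98137059e11c922b6f684e906b603a832193da54b8b11947b0358185e2f2794754f614262378a2ae16e2cd469435bc3f92419b63661e0955e27e8414b729ecdb1e518934e116cad3c017b248e118ed58bd061228e84ceade7b72714a1c3bd5bd112503cd1607935feb5bbcebf336cb43d88bfd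3fd062c143a20e07534a76081d8e7677a8e272367fdf2a2377a8605630591f5a76d4f3eb58349c90a6a6673077e024b869aae5da20264fd5a1637cb61ebcfb9c3b141d2507eabe9d41616875a013744860c423e807ec94a4184049821bfd9c75193749c86cd2757ab01dbd9f59602498210166b0d8f16ae0000000000000
  mult := 124710536722136
  order := 255
  modulus := 140737488355201
  size₁ := 173
  size₂ := 179
  size₃ := 181
  table₁ := 0x850a269a808560164a28256aaa280805291096854aa929841954a68a12024511a56081209421225026641
  table₂ := 0x100266a26912856a129158526592459092522849040a091605a56a1989a85a0468990190256526aaaa649a9001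
  table₃ := 0x11104410216aa990aa651846aa61188915a4646699664a20419568021a44269419081868686916186a102005061

theorem valid_colouring₃ : colouring₃.Valid where
  act_lt := by decide +kernel
  act_xor_two_pow := by decide +kernel
  act_ne_zero := by decide +kernel
  weight_act := by decide +kernel
  mult_pow := by decide +kernel
  key_act := by decide +kernel
  iterate_steps := by decide +kernel

theorem hasNull_three : HasNull (Fin 8 → ZMod 2) 3 3 := by
  -- A plane lies in 63 three-dimensional subspaces, 21 of each colour.
  refine valid_colouring₃.hasNull (colouring₃.detects_singleTotal 21) ?_
  decide +kernel

/-- A balanced colouring of the four-dimensional subspaces. -/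
def colouring₄ : OrbitColouring where
  -- A map of order 21 on the six lower digits, fixing the two upper ones. It has three orbits on
  -- the nonzero six-digit vectors, with representatives 1, 2 and 4.
  actTable := 0xf2d9e7ccd8f3cde6e5cef0dbcfe4daf1dcf7c9e2f6dde3c8cbe0def5e1caf4dfedc6f8d3c7ecd2f9fad1efc4d0fbc5eec3e8d6fde9c2fcd7d4ffc1eafed5ebc0b299a78c98b38da6a58eb09b8fa49ab19cb789a2b69da3888ba09eb5a18ab49fad86b89387ac92b9ba91af8490bb85ae83a896bda982bc9794bf81aabe95ab807259674c58734d66654e705b4f645a715c774962765d63484b605e75614a745f6d467853476c52797a516f44507b456e4368567d69427c57547f416a7e556b403219270c18330d26250e301b0f241a311c370922361d23080b201e35210a341f2d063813072c12393a112f04103b052e0328163d29023c17143f012a3e152b00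
  keyTable := 0xc2c1c4c4c1c1c1c4c2c1c2c4c1c2c2c2c2c2c4c2c1c4c4c1c4c4c2c2c4c2c4c4c4c2c4c2c4c2c1c1c1c1c2c4c2c1c1c2c1c1c1c4c4c2c4c1c4c2c1c4c1c2c1c0828184848181818482818284818282828282848281848481848482828482848484828482848281818181828482818182818181848482848184828184818281804241444441414144424142444142424242424442414444414444424244424444444244424442414141414244424141424141414444424441444241444142414002010404010101040201020401020202020204020104040104040202040204040402040204020101010102040201010201010104040204010402010401020100
  stepTable := 0xa0a0a0c070e05120e1307040d090506130f0e031414071109110d08060205100f0c1312030409060f031401110802100c12040b08010d10020b01000b0000000a0a0a0c070e05120e1307040d090506130f0e031414071109110d08060205100f0c1312030409060f031401110802100c12040b08010d10020b01000b0000000a0a0a0c070e05120e1307040d090506130f0e031414071109110d08060205100f0c1312030409060f031401110802100c12040b08010d10020b01000b0000000a0a0a0c070e05120e1307040d090506130f0e031414071109110d08060205100f0c1312030409060f031401110802100c12040b08010d10020b01000b000000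
  weightTable := 0xd885b688e135b7ac83d6eabb681d2a543d34b48f08a090b04b9cc46cd2d7ada015f048231b6fda132a93d4975257fd9c8ed1b7eb46d5a30b7751600c30107f6e11a7bd70c42ca4201af1f826e3527c2872ba8fc83ed449f714917467d7848c75a6ceea7635d6283641e9e8624e5baa70f32f03d6f18ac179b90fd2e0aa1c710b49fb4211cd4b4fdce96435a2bd9beab1b7836fdbf8eedaa2075fb0448d3019c7a72b912e9e044a10539d92f012a108ba4955f829ecfa9693ea75de3dce5e1e1918ad963a4821aee4ade39455cedcaee079bc8c642fbf89ca69b8624bcad00bababd197e4dd0749c1dfca4ab2882e9d526480893bf135a25343059a7676bc0263cc4aca18efa9ddbe49ad8b4220e1538f33a4a65f77aefed2929d8f20315cc71b08c2140c173b99469f1398e25497686245e4e2793846870625f2cc9e9ea94ae8d31f0832535b105bc1c3e2d4b9768a09bafdad9d21565ebc31e59acfa2cc101127236ff894003cad7ea9a727f6e6a9611dba357817b8e5c4fdeb106cd766bd6d98564c901e427c7d6d195c4b8bf360294828d5e07c7f633a412c8de761ae1fd3acf6ff9cc44def4f7ced2d0f138f2a0c6eb256bdc8b53aa4d404bcbd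8e028d6a687dd14c6d5808d110c4355ad8e4d3d2f0ed03dee9c6721912c84b87f48a9f5acb2610f0c86cb58f12a9268476c23fb88d51d59d0f85e91aa4c54dab8e9903cb095cb199ebe84d4e72ce8979a7b9d2dae9f1def57ebbbe61de2f01952cfad0e19ba0813e0459032ea1adc7dae2922cbf50e49c01a348bef03d3695a1286a3f97e99748522d3fec4549116ea840fd6e802bf33ab63ba0572f93a309ead7f8df38d3b6789c13850ccfd9c0632e7cd31dac157bc5135d4cd08ec1b9f74298c943365cb549bf8dc2cd912ba90340c54a433df807c40560bce4ea11735ca5b64c051c40fb13161996a7fd881d442c397b60f74645bd38b9fa0fbe90de05d47208766295ed5789bc1582de31bbbf79594c964405fa9d278badedc05f5f558d7c85422d52026fe133b06fd63e53b01ce4e3bd54e1447801984d503afb0f82b32a44a9ec49efd29fb03aa93334599f537af007a1c6a34012da057d5ece5f532a4c577ac2b5dcadf9a44fc35f29ddc4f37d3c0d01abe8cbd520d8b95f194dab3594ce3912ea962ecd6b87839fb0739bc21bda7ca4568ef7f3d6c89db4802e2be4381857a1317049167f28cc66424fabd76f7833ae202e7834a5414b3dd4115e6a68a83152dd429d534c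4b34fbbff1de03d546e856995e333b864e40a71e320045939364b96ee87e45a2293a9c0904c69c8cb3ad54fd76827046a78ed333f3025cc55f1c1689b2bcf784ad4a87c870d3390fe49eda7776cbf4774afd9b061bcba8d02395babaa4cd1e80f79980cfe7bd85fbb46e8210c43faf02e048782a0cb0015b4bd4c410dd0190c586221c8aa906176a84a14b1848cd2bca7ee77b8bca462bed4b19827d6cde8c1458cd94288a3bbb921d01dfa4f5451058bc4bd56155a6aa2fbf33b1cae6e6b5ac6ccac409c8db35c57b3d774e9b606438f6ed775002670024708f1e52738f245a1dd5c6eafa6c7f3c919111d2e67bacc692b79a717e514eb692e6bb17d8f68e4eff0d8b8d703e5a2f5944017d59224c4b79e214ac31880a9fae0ffacfbb0677248a6afc8b003ce953dbdd78af701fe8fddf34b772fb77077b22b1a90abc0b8be18f67a91d97487f66d651498088720f3a7e1b556133731facf5fcd1129d6557aa2fd700269492245b296c235824949a5338280768bbc23eef53e89f441a6656c1692b0f34feb57994a04f137085d7b58cdce660b9cdab60750095e3dd0ae57596d2e59bcfd7a38aa3c52c55576e135e80f96de324436be61ef904fc5f76f969adb5ebf94dfbc8fca0b6fb6b4e9d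bd1ca44bfb0deb96b2b1a611be60ddafa8644dbec757af32db2fe4acf6512b13a88c23fdbd6e671fc075d669c0a0430a30bb46bc45e5cfecd35540675d24a406bd7f6116238581966c813336266ea4f2fc864d5287d8735ee4aeb351c1903893361bf8f6f815a49e509cd94785652179bc59eb1b3e07dd4abad4ca9b1e87c952cb56802b573820d11f4baecf0ac8edfc86329230ce979df0e57a9c0b306c2f7d837576fcec5d8926000000000000
  mult := 130302252891730
  order := 21
  modulus := 262925459485879
  size₁ := 3989
  size₂ := 4001
  size₃ := 4003
  table₁ := 0x1824518aa8218190162410569865888092a192556a442141aa2999621a10118a968a04a0229826a51000665882926a916891850092a88405888605861015154652699484a1010a21519a669959942542982228220158901516629642a6a4a819996a92049a902692a6156265690288960490180195a21aa49452816658059615649105029084a5258a2248420211629884214281186016a81a29a551460525620964220601845846261a18990255a18805a6246684985640928a59a22018999665590a8688a5086084012a9251981566022801655196a560011929264425011a85864584882599a8a90842915a101511901a210241661589682a95804aa9100928416500191a6a9aa20584895296814514612296996210aa8161a0aa8582264422a0a902a519124694156612615aa52150a469011919422a6a9462a040848659495a896664086510960886251a2981050a01844060a16282a554696455a25a21050a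55248a444580441484604a4a486626458015a9684802a004501966218698585a6609665245501968a609a852069061a068a60a6a458221a5425240a29995a549a9289662a25a888550680a8581802142451641525aa92145a065665aa408282526a416999928a91814a200254a628a54a1511611849a254922202265a5220652a1894298644616a6088919601a998148146a059885196611545826a118aa889a911a8a869010402a6295695989156898440662094100662a228810a8290540120a94456292008841226a42626194916a6a8852a84995aa8060020496268941890a562064106920a1244a25a2a1aaaa91245a9a6249a2a44aa12054465581844266891200a95a8202981594248058210660aa509a88a650285448990066586299a84a6692449461154924646802aa1418464044a0a555241989aa54214042458920589928121156a598668a265118996462262a99860616a49815620220208824a55495a446644696822a566685924215a81aa2046618492095201568249a20542141848126862982150209052220404402224565450a6a1926a56552485462a199292001040126885a666a9aa56860211550829a69495661a8446a694984449815a29a2855aa26692a91a226a9651a062a121a892a5406a4a0090a9421885a6552584515229692401965802a16018a10290186868899a1651024269800942149810aa5821558440666658461558aa88a9a08406181648a050102a46a9905a1110a0510a8649946415855895aaa06060a0954854262211408a969952a480049a8aa66241141950a6811aa1968191646118069002a06208889814906802682242551404254188056901528521a542216a4911a529aa85029185494820252589869aa65809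
  table₂ := 0x2856890aa909656a068152082a6a00560a254aa5a695924498945115501299aa0146522224846651a985954450a180148894445a45125619590094968116469192466211a680082a148a111a09a55249096445542a4214598054251981450266a80919469414519615054a102a11a6085064212a0045a81844a4a99560649065484969544a9a0a52a2a015049510186a46a8a2a819118aa15a86a1065415948619905264a940a81668a65a69445104251669a55890a2280298666152968509a0229466900668116652122a1a20586058988568244a420a088844a5aa24aa4428a08518698661689419949a612a0260105aa22628008644aa5899216541218019a66849459190590582081864a60a6866509a04660591a00180a68a6618409a1a61621854a426585482569099426a99642815902985546668906a9a025659812442a4429441420041680402924155a460561928281005a421189a121414a5a512009a5a6289106a28005a619051525a1968aa8511a24949548a89a95865984695845861008a8926054991055160a0981a40484885499090956414162a259126a281050806165042156106a016498a40451a9a541a842460666a515559a9a0855a506020a6298059a16018116912946092a5109645aa6995a50624299984508556848005902065652a42591088a84561925a9825985209806a558a22856151404a9419119062225225162045194545146148094629684250a49a88080a011a262069699104860296aa4849540a1281041a28046484811826a2a1100825144a42a069044a50205511544a6a0aa0284aa850a161a88120a0562908295556a25a86011966628a2899458004598a5549014a60126a9a815866121246814000825904150025809a1a848826a951a1062566998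980460a52a05a1291219526259996281920a56950a88052a146829a5529a6a402986100998a28845959a8640198466a648080228154262a40961a265a5a458a4214a8841501548229052025a229a95a4126111105685a29a12120442801624605151454025960608a5a408550059821592115001160a8186a48182a568922a585a804a942959901461a854099a89206882a89a4192a20a51650855429a9095a156864669446a1696681001441881a26605952a849091400846a6482291645058a848699825412a9568960a944112548266116844645080002640a801960a22a0260908a109262099115aa56a0985180119a62a01582454608a2616462842866412815025561889199882621a80a521586595254911095449a918256414680808646a25041a1a022a18092981116a8895518a65060a8441a21268911082528a90506109602109056661816646a5942500aa09a0468969a00596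
  table₃ := 0x165a5582a1408082a11428262144669149900402aa6a6821908429200601255855648a9661114651a569520a252604aa1168a1219922804595861688991105582522011a1226262596a926a89a681151080a028a65582510a486414a850a4190818a91199a49294498a8024a02602a49960419601042049262218865a0a82a9255696a6a868056606025a899661196954286906a8a6a1682109a9aaa9a2225169249111041a8584400220a2450a905869420155015a985559586994a181502a64908a9a5428085a92589985091026a8a0a285044500994a94681522a80851586151252162628aa842025081020104a802a0159292a211a00295811265822951960852650a685264880688505018a65a99502215a0848899156a96454996a9495219198940810129a6945965020909562a1155000480185822200914284a40999248965112949560200698616a1251a919229a528aa5560258a0682402151606606168a89a2a0580aa08811404a4aa451a0228aaa94154484aaa09a825a506504261969584584560aa80a2a90a6611a8a605a204824116841299094a2209562192a016851664600905aa92801a890652428448699a02694582808aaa24665a625494aa5a6528984848a5a52184a548026050a14a6566852109a10165a160a4a596196842284a9a12454095481a202499695040256892581628919a5a489294650aaa9a06142a489a291259214468510846a9a8061928584a5a9452250644059896a649a5a65844511286a202aaa8524912986210024a6a015481248259669925462418519a8559009a158012819468461265a0294404a455156981965495018100a0808202486142468684229989581521aa0545804582496654559a21505a5586120a6604858025624166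505420204469aa824268011146a4a819a012128a20560012468202125429405604601a02619961149868a696554465a1560181490416841a05180240021a2508686955a00a6010aa85a9002662162240052481856021946652581204a5611a42250a24a802884480521528429408401921982aa445a21990100298592a8900a992129601844518148a80656519509a2921804698554599882a161246828a8a2982a6a08a8a8aa41101a885a996a6082a48168819909014895499094562802465069894914004451661582619468125a161a018264828464259521221145248692a566020550684684489044200424498846268482662068148a5295a5a919025a55455aa95981940a9a4a96805a622946998a168a2a922a6198a891544484042885108590914184aa9615454828a8041a5482a959a44020508158606928826086a54a202650198a410196a025aa848109095545a642450261666aa06901a6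

theorem valid_colouring₄ : colouring₄.Valid where
  act_lt := by decide +kernel
  act_xor_two_pow := by decide +kernel
  act_ne_zero := by decide +kernel
  weight_act := by decide +kernel
  mult_pow := by decide +kernel
  key_act := by decide +kernel
  iterate_steps := by decide +kernel

theorem rowCheck_colouring₄_one : colouring₄.rowCheck colouring₄.pairTotal 217 1 = true := by
  decide +kernel

theorem rowCheck_colouring₄_two : colouring₄.rowCheck colouring₄.pairTotal 217 2 = true := by
  decide +kernel

theorem rowCheck_colouring₄_four : colouring₄.rowCheck colouring₄.pairTotal 217 4 = true := by
  decide +kernel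

theorem rowCheck_colouring₄_of_lt_seventy : ∀ x < 70, 4 < x → colouring₄.key x = x →
    colouring₄.rowCheck colouring₄.pairTotal 217 x = true := by
  decide +kernel

theorem rowCheck_colouring₄_of_ge_seventy : ∀ x < 256, 70 ≤ x → colouring₄.key x = x →
    colouring₄.rowCheck colouring₄.pairTotal 217 x = true := by
  decide +kernel

theorem hasNull_four : HasNull (Fin 8 → ZMod 2) 4 3 := by
  -- A plane lies in 651 four-dimensional subspaces, 217 of each colour.
  refine valid_colouring₄.hasNull (colouring₄.detects_pairTotal 217) fun x hx h0 hkey => ?_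
  rcases Nat.lt_or_ge 4 x with h | h
  · rcases Nat.lt_or_ge x 70 with h' | h'
    exacts [rowCheck_colouring₄_of_lt_seventy x h' h hkey,
      rowCheck_colouring₄_of_ge_seventy x hx h' hkey]
  have h3 : colouring₄.key 3 ≠ 3 := by decide +kernel
  obtain rfl | rfl | rfl | rfl : x = 1 ∨ x = 2 ∨ x = 3 ∨ x = 4 := by omega
  exacts [rowCheck_colouring₄_one, rowCheck_colouring₄_two, absurd hkey h3,
    rowCheck_colouring₄_four]

theorem theorem1 (v k : ℕ) (hv : 8 ≤ v) (hkv : k ≤ v)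
    (h : 2 ≤ v % 6 ∧ v % 6 < k % 6 ∧ k % 6 ≤ 5)
    (V : Type*) [AddCommGroup V] [Module (ZMod 2) V] [FiniteDimensional (ZMod 2) V]
    (hV : Module.finrank (ZMod 2) V = v) :
    ∃ 𝓑 : Fin 3 → Set (Submodule (ZMod 2) V), IsLargeSet 3 2 k v 𝓑 := by
  exact exists_isLargeSet hasNull_three hasNull_four hkv h V hV
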